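/- For an integer $n\ge 2$ let $x_0=(1,0,\dots,0)\in\mathbf R^n$ and let $(x_k)_{k\ge 0}$ be the Markov chain in which, given $x_k$, two distinct coordinates $I,J$ are chosen uniformly at random (independently of the past) and $x_{k,I}$ and $x_{k,J}$ are both replaced by $(x_{k,I}+x_{k,J})/2$, the other coordinates being unchanged, to give $x_{k+1}$. Let $T(k)=\sum_{i=1}^n |x_{k,i}-\tfrac1n|$. Let $(N_t)_{t\ge0}$ be a rate $1$ Poisson process independent of the choices of pairs, and let $T'(t)=T(N_t)$ be the corresponding quantity for the continuous-time process, in which an averaging step is made at each jump of $N$. Let $\Phi$ be the cumulative distribution function of the standard normal distribution. Then, as $n\to\infty$: (1) for every $a\in\mathbf R$, $T\bigl(\lfloor n(\log_2 n+a\sqrt{\log_2 n})/2\rfloor\bigr)\to 2\Phi(-a)$ in probability; (2) for every $a\in\mathbf R$, $T'\bigl(n(\log_2 n+a\sqrt{\log_2 n})/2\bigr)\to 2\Phi(-a)$ in probability; (3) consequently $T$ has a cutoff at $\tfrac12 n\log_2 n$ with a window of order $n\sqrt{\log n}$, in the following sense: for integers $k_n\ge0$, put $s_n=(k_n-\tfrac12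 n\log_2 n)/(n\sqrt{\log n})$. Then $T(k_n)$ converges in probability to $2$ if $s_n\to-\infty$, to $1$ if $s_n\to0$, and to $0$ if $s_n\to+\infty$. (Times that are negative, which happens for only finitely many $n$ for each $a$, are read as $0$.) -/

import Mathlib

open MeasureTheory ProbabilityTheory Filter Topology
open scoped NNReal ENNReal

namespace RepeatedAverages

/-- Replace both coordinates `x p.1` and `x p.2` of `x` by their average, and keep the others. -/
noncomputable def averagePair {n : ℕ} (p : Fin n × Fin n) (x : Fin n → ℝ) : Fin n → ℝ :=
  fun i => if i = p.1 ∨ i = p.2 then (x p.1 + x p.2) / 2 else x i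

/-- The repeated averages `x_k` started from `x₀`, where step `k + 1` averages the pair `p k`. -/
noncomputable def chain {n : ℕ} (x₀ : Fin n → ℝ) (p : ℕ → Fin n × Fin n) : ℕ → Fin n → ℝ
  | 0 => x₀
  | k + 1 => averagePair (p k) (chain x₀ p k)

/-- The mean of the coordinates of `x`. -/
noncomputable def mean {n : ℕ} (x : Fin n → ℝ) : ℝ := (∑ i, x i) / n

/-- The starting vector `(1, 0, …, 0)`. -/
def firstUnit (n : ℕ) : Fin n → ℝ := fun i => if (i : ℕ) = 0 then 1 else 0

/-- The `L¹` distance `T(k) = ∑ i, |x_{k,i} - mean x₀|` after `k` steps from `x₀ = (1, 0, …, 0)`. -/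
noncomputable def T {n : ℕ} (p : ℕ → Fin n × Fin n) (k : ℕ) : ℝ :=
  ∑ i, |chain (firstUnit n) p k i - mean (firstUnit n)|

/-- `p 0, p 1, …` are independent, each uniform on the ordered pairs of distinct coordinates. -/
structure IsUniformPairs {n : ℕ} {Ω : Type*} [MeasurableSpace Ω] (P : Measure Ω)
    (p : ℕ → Ω → Fin n × Fin n) : Prop where
  measurable : ∀ k, Measurable (p k)
  indep : iIndepFun p P
  law : ∀ k, P.map (p k) = uniformOn {q : Fin n × Fin n | q.1 ≠ q.2}

/-- `N` is a rate one Poisson process on `[0, ∞)`: `N t` is the number of rings of a rate one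
Poisson clock up to time `t`. As the paths are almost surely monotone, the truncated
difference `N t - N s` of natural numbers is the true increment for `s ≤ t`. -/
structure IsPoissonProcess {Ω : Type*} [MeasurableSpace Ω] (P : Measure Ω)
    (N : ℝ≥0 → Ω → ℕ) : Prop where
  measurable : ∀ t, Measurable (N t)
  zero : ∀ᵐ ω ∂P, N 0 ω = 0
  mono : ∀ᵐ ω ∂P, Monotone fun t => N t ω
  rightCont : ∀ᵐ ω ∂P, ∀ t, ContinuousWithinAt (fun s => N s ω) (Set.Ici t) t
  indepIncrements : HasIndepIncrements N P
  law : ∀ s t, s ≤ t → P.map (N t - N s) = poissonMeasure (t - s)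

/-- Convergence in probability to a constant, along a directed index set, of random variables
that may live on different probability spaces. -/
def TendstoInProb {ι : Type*} [Preorder ι] {Ω : ι → Type*} [∀ n, MeasurableSpace (Ω n)]
    (P : ∀ n, Measure (Ω n)) (X : ∀ n, Ω n → ℝ) (c : ℝ) : Prop :=
  ∀ ε : ℝ, 0 < ε → Tendsto (fun n => P n {ω | ε ≤ |X n ω - c|}) atTop (𝓝 0)

/-- The time `n (log₂ n + a √(log₂ n)) / 2`. -/
noncomputable def cutoffTime (n : ℕ) (a : ℝ) : ℝ :=
  n * (Real.logb 2 n + a * √(Real.logb 2 n)) / 2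

/-- The deviation of the time `k` from `n log₂ n / 2`, in units of `n √(log n)`. -/
noncomputable def windowPos (n k : ℕ) : ℝ :=
  (k - n * Real.logb 2 n / 2) / (n * √(Real.log n))

/-- The cumulative distribution function of the standard normal distribution. -/
noncomputable def stdNormalCDF (x : ℝ) : ℝ := cdf (gaussianReal 0 1) x

end RepeatedAverages

open RepeatedAverages

/-! Why the theorem holds. Given the pairs, let a walker start at the first coordinate and, whenever
its coordinate is picked, score a point and move to a uniform element of the pair. Then `x_{k,i}` is
the conditional probability that the walker is at `i` after `k` steps, given the pairs. Its score
after `k` steps is binomial with parameters `k` and `2 / n`, so at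
`k = n (log₂ n + a √(log₂ n)) / 2` the score minus `log₂ n`, divided by `√(log₂ n)`, is
asymptotically normal with mean `a` and variance `1`. Let `Q_k(g)` be the conditional probability,
given the pairs, of a score of at most `g` (`slowMass`). Take `g` slightly below `log₂ n`.

* Lower bound (`slowMass_le_dist`): a coordinate reached with score at most `g` has value at least
  `2 ^ (-g)`, far above `1 / n`, hence `T(k) ≥ 2 (1 - 2 ^ g / n) Q_k(g)`.
* Upper bound (`dist_append_le`, `avgLists_deviation_le`): averaging is linear, so the part of the
  mass with score at most `g` contributes at most `2 Q_k(g)` to all later distances. The remaining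
  mass has expected squared norm at most `2 ^ (-g - 1) + 1 / (n - 1)`, and the contraction of the
  squared norm flattens it within a number of steps that is negligible against the window.
* Concentration (`avgLists_slowMass_sq_le`): the second moment of `Q_k(g)` involves two walkers in
  the same environment. They separate quickly, and afterwards they are independent up to an error
  of order `k / n ^ 2`. Therefore `Q_k(g)` has the same limit `Φ(-a)` in mean square as its
  expectation (`tendsto_binCDF`, by characteristic functions).

All expectations over the pairs are finite averages over lists (`avgLists`); the link with the
given probability space is `IsUniformPairs.integral_eq_avgLists`. The statements in continuous time
and on the window follow from the one in discrete time, because `T` is nonincreasing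
(`T_antitone`) and the limit is continuous in `a`. For the Poisson clock, Chebyshev's inequality
places `N_t` between two cutoff times with nearby parameters.
-/

namespace RepeatedAverages

/-! ### Averages over pairs and over lists of pairs -/

/-- The average of `f` over the ordered pairs of distinct elements of `Fin n`. -/
noncomputable def avgPairs {n : ℕ} (f : Fin n × Fin n → ℝ) : ℝ :=
  (∑ q : Fin n × Fin n with q.1 ≠ q.2, f q) / (n * (n - 1))

/-- The average of `F` over the lists of `k` ordered pairs of distinct elements of `Fin n`. -/
noncomputable def avgLists {n : ℕ} : ℕ → (List (Fin n × Fin n) → ℝ) → ℝ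
  | 0, F => F []
  | k + 1, F => avgPairs fun q => avgLists k fun L => F (q :: L)

/-- The indicator of the event that the coordinate `i` belongs to the pair `p`. -/
noncomputable def hit {n : ℕ} (i : Fin n) (p : Fin n × Fin n) : ℝ :=
  if i = p.1 ∨ i = p.2 then 1 else 0

section Averages

variable {n : ℕ}

lemma sum_distinct (f : Fin n × Fin n → ℝ) :
    ∑ q : Fin n × Fin n with q.1 ≠ q.2, f q = ∑ i, ∑ j, f (i, j) - ∑ i, f (i, i) := by
  rw [Finset.sum_filter, Fintype.sum_prod_type, ← Finset.sum_sub_distrib]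
  refine Finset.sum_congr rfl fun i _ => ?_
  rw [eq_sub_iff_add_eq]
  have : f (i, i) = ∑ j, if i = j then f (i, j) else 0 := by simp
  rw [this, ← Finset.sum_add_distrib]
  refine Finset.sum_congr rfl fun j _ => ?_
  by_cases h : i = j <;> simp [h]

lemma pairs_weight_nonneg : (0 : ℝ) ≤ n * (n - 1) := by
  rcases n with _ | n
  · simp
  · push_cast; rw [add_sub_cancel_right]; positivity

lemma avgPairs_congr {f g : Fin n × Fin n → ℝ} (h : ∀ q, q.1 ≠ q.2 → f q = g q) :
    avgPairs f = avgPairs g := by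
  unfold avgPairs
  rw [Finset.sum_congr rfl]
  intro q hq
  exact h q (by simpa using hq)

lemma avgPairs_mono {f g : Fin n × Fin n → ℝ} (h : ∀ q, q.1 ≠ q.2 → f q ≤ g q) :
    avgPairs f ≤ avgPairs g := by
  unfold avgPairs
  refine div_le_div_of_nonneg_right (Finset.sum_le_sum ?_) pairs_weight_nonneg
  intro q hq
  exact h q (by simpa using hq)

lemma avgPairs_add (f g : Fin n × Fin n → ℝ) :
    avgPairs (fun q => f q + g q) = avgPairs f + avgPairs g := by
  simp only [avgPairs, Finset.sum_add_distrib, add_div]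

lemma avgPairs_const_mul (c : ℝ) (f : Fin n × Fin n → ℝ) :
    avgPairs (fun q => c * f q) = c * avgPairs f := by
  simp only [avgPairs, ← Finset.mul_sum, mul_div_assoc]

lemma avgPairs_const (hn : 2 ≤ n) (c : ℝ) : avgPairs (fun _ : Fin n × Fin n => c) = c := by
  have h : (2 : ℝ) ≤ n := by exact_mod_cast hn
  rw [avgPairs, sum_distinct]
  simp only [Finset.sum_const, Finset.card_univ, Fintype.card_fin, nsmul_eq_mul]
  rw [div_eq_iff (by nlinarith)]
  ring

lemma hit_eq (i : Fin n) {p : Fin n × Fin n} (hp : p.1 ≠ p.2) :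
    hit i p = (if i = p.1 then 1 else 0) + (if i = p.2 then 1 else 0) := by
  unfold hit
  by_cases h1 : i = p.1
  · have : i ≠ p.2 := h1 ▸ hp
    simp [h1, hp]
  · simp [h1]

lemma avgPairs_fst_add_snd (hn : 2 ≤ n) (f : Fin n → ℝ) :
    avgPairs (fun q : Fin n × Fin n => f q.1 + f q.2) = 2 / n * ∑ i, f i := by
  have h : (2 : ℝ) ≤ n := by exact_mod_cast hn
  have h1 : (n : ℝ) - 1 ≠ 0 := by linarith
  rw [avgPairs, sum_distinct]
  simp only [Finset.sum_add_distrib, Finset.sum_const, Finset.card_univ, Fintype.card_fin,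
    nsmul_eq_mul, ← Finset.mul_sum]
  field_simp
  ring

lemma avgPairs_mul (u : Fin n → ℝ) :
    avgPairs (fun q : Fin n × Fin n => u q.1 * u q.2)
      = ((∑ i, u i) ^ 2 - ∑ i, u i ^ 2) / (n * (n - 1)) := by
  rw [avgPairs, sum_distinct]
  simp only [← Finset.mul_sum, ← Finset.sum_mul, sq]

lemma avgPairs_hit (hn : 2 ≤ n) (i : Fin n) : avgPairs (hit i) = 2 / n := by
  rw [avgPairs_congr fun q hq => hit_eq i hq,
    avgPairs_fst_add_snd hn fun j => if i = j then (1 : ℝ) else 0]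
  simp

lemma avgPairs_hit_mul_hit {i j : Fin n} (hij : i ≠ j) :
    avgPairs (fun q => hit i q * hit j q) = 2 / (n * (n - 1)) := by
  have key : ∀ q : Fin n × Fin n, q.1 ≠ q.2 → hit i q * hit j q =
      (if i = q.1 then 1 else 0) * (if j = q.2 then 1 else 0)
        + (if j = q.1 then 1 else 0) * (if i = q.2 then 1 else 0) := by
    intro q hq
    rw [hit_eq i hq, hit_eq j hq]
    by_cases h1 : i = q.1 <;> by_cases h2 : i = q.2 <;> by_cases h3 : j = q.1 <;>
      by_cases h4 : j = q.2 <;> simp_all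
  rw [avgPairs_congr key, avgPairs, sum_distinct]
  simp [Finset.sum_add_distrib, hij, hij.symm]
  norm_num

lemma avgLists_mono {k : ℕ} {F G : List (Fin n × Fin n) → ℝ}
    (h : ∀ L, F L ≤ G L) : avgLists k F ≤ avgLists k G := by
  induction k generalizing F G with
  | zero => exact h []
  | succ k ih => exact avgPairs_mono fun q _ => ih fun L => h _

lemma avgLists_add (k : ℕ) (F G : List (Fin n × Fin n) → ℝ) :
    avgLists k (fun L => F L + G L) = avgLists k F + avgLists k G := by
  induction k generalizing F G with
  | zero => rfl
  | succ k ih => simp only [avgLists, ih, avgPairs_add]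

lemma avgLists_const_mul (k : ℕ) (c : ℝ) (F : List (Fin n × Fin n) → ℝ) :
    avgLists k (fun L => c * F L) = c * avgLists k F := by
  induction k generalizing F with
  | zero => rfl
  | succ k ih => simp only [avgLists, ih, avgPairs_const_mul]

lemma avgLists_const (hn : 2 ≤ n) (k : ℕ) (c : ℝ) :
    avgLists k (fun _ : List (Fin n × Fin n) => c) = c := by
  induction k with
  | zero => rfl
  | succ k ih => simp only [avgLists, ih, avgPairs_const hn]

lemma avgLists_append (k l : ℕ) (F : List (Fin n × Fin n) → ℝ) :
    avgLists (k + l) F = avgLists k fun L => avgLists l fun L' => F (L ++ L') := by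
  induction k generalizing F with
  | zero => simp [avgLists]
  | succ k ih => simp only [Nat.succ_add, avgLists, ih, List.cons_append]

end Averages

/-! ### The walker in the environment of pairs -/

/-- The result of averaging the pairs of `L` in turn, starting from `x`. -/
noncomputable def averageList {n : ℕ} (L : List (Fin n × Fin n)) (x : Fin n → ℝ) : Fin n → ℝ :=
  L.foldl (fun x p => averagePair p x) x

/-- One step of a walker among the coordinates that, when its coordinate belongs to `p`, scores a
point and moves to a uniformly chosen element of `p`. Here `y g i` is the probability that the
walker is at `i` and that its score is in a fixed relation to the threshold `g`, such as `≤ g` or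
`> g`; a point scored shifts the threshold from `g` to `g - 1`. -/
noncomputable def walkStep {n : ℕ} (p : Fin n × Fin n) (y : ℤ → Fin n → ℝ) : ℤ → Fin n → ℝ :=
  fun g i => if i = p.1 ∨ i = p.2 then (y (g - 1) p.1 + y (g - 1) p.2) / 2 else y g i

/-- The walker steps along the pairs of `L`. -/
noncomputable def walk {n : ℕ} (L : List (Fin n × Fin n)) (y : ℤ → Fin n → ℝ) : ℤ → Fin n → ℝ :=
  L.foldl (fun y p => walkStep p y) y

/-- A walker at `j` with score zero, recorded through the events that the score is at most `g`. -/
def startAt {n : ℕ} (j : Fin n) : ℤ → Fin n → ℝ := fun g i => if 0 ≤ g ∧ i = j then 1 else 0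

/-- A walker at `j` with score zero, recorded through the events that the score exceeds `g`. -/
def startAbove {n : ℕ} (j : Fin n) : ℤ → Fin n → ℝ := fun g i => if g < 0 ∧ i = j then 1 else 0

/-- The probability, given the pairs in `L`, that a walker from `j` scores at most `g`. -/
noncomputable def slowMass {n : ℕ} (j : Fin n) (L : List (Fin n × Fin n)) (g : ℤ) : ℝ :=
  ∑ i, walk L (startAt j) g i

section Walk

variable {n : ℕ}

lemma walk_append (L L' : List (Fin n × Fin n)) (y : ℤ → Fin n → ℝ) :
    walk (L ++ L') y = walk L' (walk L y) := List.foldl_append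

lemma averageList_append (L L' : List (Fin n × Fin n)) (x : Fin n → ℝ) :
    averageList (L ++ L') x = averageList L' (averageList L x) := List.foldl_append

lemma averagePair_add (p : Fin n × Fin n) (x y : Fin n → ℝ) :
    averagePair p (x + y) = averagePair p x + averagePair p y := by
  ext i; simp only [averagePair, Pi.add_apply]; split_ifs <;> ring

lemma averageList_add (L : List (Fin n × Fin n)) (x y : Fin n → ℝ) :
    averageList L (x + y) = averageList L x + averageList L y := by
  induction L generalizing x y with
  | nil => rfl
  | cons p L ih =>
    simp only [averageList, List.foldl_cons] at ih ⊢
    rw [averagePair_add, ih]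

/-- Forgetting the score: the walker's position splits according to whether the score is at most
`g`, and its law given the pairs is the repeated average of the starting vector. -/
lemma walk_start_add (L : List (Fin n × Fin n)) (j : Fin n) (g : ℤ) (i : Fin n) :
    walk L (startAt j) g i + walk L (startAbove j) g i = averageList L (Pi.single j 1) i := by
  have gen : ∀ (L : List (Fin n × Fin n)) (y z : ℤ → Fin n → ℝ) (x : Fin n → ℝ),
      (∀ g i, y g i + z g i = x i) → ∀ g i, walk L y g i + walk L z g i = averageList L x i := by
    intro L
    induction L with
    | nil => exact fun y z x h => h
    | cons p L ih =>
      intro y z x h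
      refine ih _ _ _ fun g i => ?_
      simp only [walkStep, averagePair]
      split_ifs
      · linarith [h (g - 1) p.1, h (g - 1) p.2]
      · exact h g i
  refine gen L _ _ _ (fun g i => ?_) g i
  simp only [startAt, startAbove, Pi.single_apply]
  by_cases h : i = j <;> by_cases h' : 0 ≤ g <;> simp [h, h', not_lt.2, not_le.1]

lemma walk_nonneg (L : List (Fin n × Fin n)) {y : ℤ → Fin n → ℝ} (hy : ∀ g i, 0 ≤ y g i)
    (g : ℤ) (i : Fin n) : 0 ≤ walk L y g i := by
  induction L generalizing y g i with
  | nil => exact hy g i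
  | cons p L ih =>
    refine ih (fun g i => ?_) g i
    simp only [walkStep]
    split_ifs
    · linarith [hy (g - 1) p.1, hy (g - 1) p.2]
    · exact hy g i

lemma startAt_nonneg (j : Fin n) (g : ℤ) (i : Fin n) : 0 ≤ startAt j g i := by
  unfold startAt; split_ifs <;> simp

lemma startAbove_nonneg (j : Fin n) (g : ℤ) (i : Fin n) : 0 ≤ startAbove j g i := by
  unfold startAbove; split_ifs <;> simp

lemma sum_pair_ite {p : Fin n × Fin n} (hp : p.1 ≠ p.2) (c : ℝ) (x : Fin n → ℝ) :
    (∑ i, if i = p.1 ∨ i = p.2 then c else x i) = ∑ i, x i - x p.1 - x p.2 + 2 * c := by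
  have h : ∀ i, (if i = p.1 ∨ i = p.2 then c else x i) =
      x i + (if i = p.1 then c - x p.1 else 0) + (if i = p.2 then c - x p.2 else 0) := by
    intro i
    by_cases h1 : i = p.1
    · have : i ≠ p.2 := h1 ▸ hp
      simp [h1, hp]
    · by_cases h2 : i = p.2 <;> simp [h1, h2, hp.symm]
  simp only [h, Finset.sum_add_distrib, Finset.sum_ite_eq', Finset.mem_univ, if_true]
  ring

lemma sum_averagePair {p : Fin n × Fin n} (x : Fin n → ℝ) :
    ∑ i, averagePair p x i = ∑ i, x i := by
  by_cases hp : p.1 = p.2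
  · refine Finset.sum_congr rfl fun i _ => ?_
    simp only [averagePair, hp]
    split_ifs with h
    · rcases h with h | h <;> rw [h] <;> ring
    · rfl
  · simp only [averagePair, sum_pair_ite hp]
    ring

lemma sum_averageList (L : List (Fin n × Fin n)) (x : Fin n → ℝ) :
    ∑ i, averageList L x i = ∑ i, x i := by
  induction L generalizing x with
  | nil => rfl
  | cons p L ih => exact (ih _).trans (sum_averagePair x)

lemma slowMass_nonneg (j : Fin n) (L : List (Fin n × Fin n)) (g : ℤ) : 0 ≤ slowMass j L g :=
  Finset.sum_nonneg fun i _ => walk_nonneg L (startAt_nonneg j) g i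

lemma slowMass_le_one (j : Fin n) (L : List (Fin n × Fin n)) (g : ℤ) : slowMass j L g ≤ 1 := by
  have h : ∑ i, averageList L (Pi.single j 1) i = 1 := by
    rw [sum_averageList]; simp
  rw [← h]
  refine Finset.sum_le_sum fun i _ => ?_
  rw [← walk_start_add L j g i]
  linarith [walk_nonneg L (startAbove_nonneg j) g i]

lemma slowMass_nil (j : Fin n) (g : ℤ) : slowMass j [] g = if 0 ≤ g then 1 else 0 := by
  by_cases h : 0 ≤ g <;> simp [slowMass, walk, startAt, h]

/-- Equal mixtures of two walks, both with one point already scored, evolve as mixtures. -/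
lemma walk_shift (L : List (Fin n × Fin n)) (y z : ℤ → Fin n → ℝ) (g : ℤ) (i : Fin n) :
    walk L (fun g i => (y (g - 1) i + z (g - 1) i) / 2) g i
      = (walk L y (g - 1) i + walk L z (g - 1) i) / 2 := by
  induction L generalizing y z with
  | nil => rfl
  | cons p L ih =>
    rw [walk, List.foldl_cons]
    have : walkStep p (fun g i => (y (g - 1) i + z (g - 1) i) / 2) =
        fun g i => (walkStep p y (g - 1) i + walkStep p z (g - 1) i) / 2 := by
      ext g i
      simp only [walkStep]
      split_ifs <;> ring
    rw [this]
    exact ih _ _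

/-- Conditioning on the first move of the walker. -/
lemma slowMass_cons_of_hit {j : Fin n} {p : Fin n × Fin n} (hp : p.1 ≠ p.2)
    (h : j = p.1 ∨ j = p.2) (L : List (Fin n × Fin n)) (g : ℤ) :
    slowMass j (p :: L) g = (slowMass p.1 L (g - 1) + slowMass p.2 L (g - 1)) / 2 := by
  have key : walkStep p (startAt j) =
      fun g i => (startAt p.1 (g - 1) i + startAt p.2 (g - 1) i) / 2 := by
    ext g i
    simp only [walkStep, startAt]
    rcases h with rfl | rfl <;> by_cases h1 : i = p.1 <;> by_cases h2 : i = p.2 <;>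
      by_cases h3 : 0 ≤ g - 1 <;> simp_all [Ne.symm]
  simp only [slowMass]
  rw [← Finset.sum_add_distrib, Finset.sum_div]
  refine Finset.sum_congr rfl fun i _ => ?_
  rw [walk, List.foldl_cons, key]
  exact walk_shift L _ _ g i

lemma slowMass_cons_of_not_hit {j : Fin n} {p : Fin n × Fin n}
    (h : ¬(j = p.1 ∨ j = p.2)) (L : List (Fin n × Fin n)) (g : ℤ) :
    slowMass j (p :: L) g = slowMass j L g := by
  have key : walkStep p (startAt j) = startAt j := by
    ext g i
    simp only [walkStep, startAt]
    push Not at h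
    split_ifs <;> simp_all
  simp only [slowMass]
  rw [walk, List.foldl_cons, key]
  rfl

end Walk

/-! ### First and second moments of the slow mass -/

/-- The probability that `k` independent trials of success probability `s` have at most `g`
successes. -/
noncomputable def binCDF (s : ℝ) : ℕ → ℤ → ℝ
  | 0, g => if 0 ≤ g then 1 else 0
  | k + 1, g => (1 - s) * binCDF s k g + s * binCDF s k (g - 1)

section BinCDF

variable {s : ℝ}

lemma binCDF_nonneg (h0 : 0 ≤ s) (h1 : s ≤ 1) (k : ℕ) (g : ℤ) : 0 ≤ binCDF s k g := by
  induction k generalizing g with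
  | zero => unfold binCDF; split_ifs <;> simp
  | succ k ih =>
    have := ih g
    have := ih (g - 1)
    have : 0 ≤ 1 - s := by linarith
    unfold binCDF
    positivity

lemma binCDF_le_one (h0 : 0 ≤ s) (h1 : s ≤ 1) (k : ℕ) (g : ℤ) : binCDF s k g ≤ 1 := by
  induction k generalizing g with
  | zero => unfold binCDF; split_ifs <;> simp
  | succ k ih =>
    unfold binCDF
    nlinarith [ih g, ih (g - 1)]

lemma binCDF_pred_le (h0 : 0 ≤ s) (h1 : s ≤ 1) (k : ℕ) (g : ℤ) :
    binCDF s k (g - 1) ≤ binCDF s k g := by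
  induction k generalizing g with
  | zero =>
    unfold binCDF
    split_ifs
    · exact le_rfl
    · omega
    · simp
    · exact le_rfl
  | succ k ih =>
    unfold binCDF
    nlinarith [ih g, ih (g - 1)]

lemma binCDF_succ_le (h0 : 0 ≤ s) (h1 : s ≤ 1) (k : ℕ) (g : ℤ) :
    binCDF s (k + 1) g ≤ binCDF s k g := by
  rw [binCDF]
  nlinarith [binCDF_pred_le h0 h1 k g]

lemma binCDF_anti (h0 : 0 ≤ s) (h1 : s ≤ 1) (k m : ℕ) (g : ℤ) :
    binCDF s (k + m) g ≤ binCDF s k g := by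
  induction m with
  | zero => exact le_rfl
  | succ m ih => exact (binCDF_succ_le h0 h1 (k + m) g).trans ih

end BinCDF

section Moments

variable {n : ℕ}

lemma two_div_le_one (hn : 2 ≤ n) : (2 : ℝ) / n ≤ 1 := by
  have : (2 : ℝ) ≤ n := by exact_mod_cast hn
  rw [div_le_one (by linarith)]; exact this

lemma avgLists_slowMass (hn : 2 ≤ n) (k : ℕ) (j : Fin n) (g : ℤ) :
    avgLists k (fun L => slowMass j L g) = binCDF (2 / n) k g := by
  induction k generalizing j g with
  | zero => simp [avgLists, slowMass_nil, binCDF]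
  | succ k ih =>
    have key : ∀ q : Fin n × Fin n, q.1 ≠ q.2 → avgLists k (fun L => slowMass j (q :: L) g) =
        binCDF (2 / n) k g + (binCDF (2 / n) k (g - 1) - binCDF (2 / n) k g) * hit j q := by
      intro q hq
      by_cases h : j = q.1 ∨ j = q.2
      · have e : (fun L => slowMass j (q :: L) g) = fun L =>
            (1 / 2) * slowMass q.1 L (g - 1) + (1 / 2) * slowMass q.2 L (g - 1) := by
          ext L; rw [slowMass_cons_of_hit hq h]; ring
        rw [e, avgLists_add, avgLists_const_mul, avgLists_const_mul, ih, ih, hit, if_pos h]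
        ring
      · simp only [slowMass_cons_of_not_hit h, ih, hit, if_neg h]
        ring
    rw [avgLists, avgPairs_congr key, avgPairs_add, avgPairs_const hn, avgPairs_const_mul,
      avgPairs_hit hn, binCDF]
    ring

/-- Two walkers that start at distinct coordinates are nearly independent: their moves interact
only when the pair consists of their two coordinates, which has probability `O(1 / n ^ 2)`. -/
lemma avgLists_slowMass_mul_le (hn : 2 ≤ n) (k : ℕ) {i j : Fin n} (hij : i ≠ j) (g h : ℤ) :
    avgLists k (fun L => slowMass i L g * slowMass j L h)
      ≤ binCDF (2 / n) k g * binCDF (2 / n) k h + 16 * k / n ^ 2 := by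
  have hn' : (2 : ℝ) ≤ n := by exact_mod_cast hn
  have hs1 := two_div_le_one hn
  have hs0 : (0 : ℝ) ≤ 2 / n := by positivity
  induction k generalizing i j g h with
  | zero => simp [avgLists, slowMass_nil, binCDF]
  | succ k ih =>
    set s : ℝ := 2 / n with hs
    set e : ℝ := 16 * k / n ^ 2 with he
    have he0 : 0 ≤ e := by positivity
    set b := binCDF s k with hb
    have b0 := binCDF_nonneg hs0 hs1 k
    have b1 := binCDF_le_one hs0 hs1 k
    rw [← hb] at b0 b1
    have key : ∀ q : Fin n × Fin n, q.1 ≠ q.2 →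
        avgLists k (fun L => slowMass i (q :: L) g * slowMass j (q :: L) h) ≤
        (b g * b h + e) + ((b (g - 1) * b h - b g * b h) * hit i q +
          ((b g * b (h - 1) - b g * b h) * hit j q +
          (1 - b (g - 1) * b h - b g * b (h - 1) + b g * b h) * (hit i q * hit j q))) := by
      intro q hq
      by_cases hi : i = q.1 ∨ i = q.2 <;> by_cases hj : j = q.1 ∨ j = q.2
      -- both walkers are picked: the product is only bounded by `1`, an event of small probability
      · have : avgLists k (fun L => slowMass i (q :: L) g * slowMass j (q :: L) h) ≤
            avgLists k (fun _ : List (Fin n × Fin n) => (1 : ℝ)) :=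
          avgLists_mono fun L => mul_le_one₀ (slowMass_le_one _ _ _) (slowMass_nonneg _ _ _)
            (slowMass_le_one _ _ _)
        rw [avgLists_const hn] at this
        simp only [hit, if_pos hi, if_pos hj]
        linarith
      · have e1 : (fun L => slowMass i (q :: L) g * slowMass j (q :: L) h) = fun L =>
            (1 / 2) * (slowMass q.1 L (g - 1) * slowMass j L h)
              + (1 / 2) * (slowMass q.2 L (g - 1) * slowMass j L h) := by
          ext L
          rw [slowMass_cons_of_hit hq hi, slowMass_cons_of_not_hit hj]; ring
        rw [e1, avgLists_add, avgLists_const_mul, avgLists_const_mul]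
        push Not at hj
        have h1 := ih hj.1.symm (g - 1) h
        have h2 := ih hj.2.symm (g - 1) h
        simp only [hit, if_pos hi, if_neg (not_or.2 hj)]
        linarith
      · have e1 : (fun L => slowMass i (q :: L) g * slowMass j (q :: L) h) = fun L =>
            (1 / 2) * (slowMass i L g * slowMass q.1 L (h - 1))
              + (1 / 2) * (slowMass i L g * slowMass q.2 L (h - 1)) := by
          ext L
          rw [slowMass_cons_of_hit hq hj, slowMass_cons_of_not_hit hi]; ring
        rw [e1, avgLists_add, avgLists_const_mul, avgLists_const_mul]
        push Not at hi
        have h1 := ih hi.1 g (h - 1)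
        have h2 := ih hi.2 g (h - 1)
        simp only [hit, if_pos hj, if_neg (not_or.2 hi)]
        linarith
      · simp only [slowMass_cons_of_not_hit hi, slowMass_cons_of_not_hit hj]
        have := ih hij g h
        simp only [hit, if_neg hi, if_neg hj]
        linarith
    rw [avgLists]
    refine (avgPairs_mono key).trans ?_
    rw [avgPairs_add, avgPairs_const hn, avgPairs_add, avgPairs_add, avgPairs_const_mul,
      avgPairs_const_mul, avgPairs_const_mul, avgPairs_hit hn, avgPairs_hit hn,
      avgPairs_hit_mul_hit hij, ← hs]
    -- the exact product law gives both walkers a point with probability `s ^ 2` instead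
    have hq : (2 : ℝ) / (n * (n - 1)) ≤ s ^ 2 := by
      rw [hs, div_pow, div_le_div_iff₀ (by nlinarith) (by positivity)]
      nlinarith
    have hq0 : (0 : ℝ) ≤ 2 / (n * (n - 1)) := div_nonneg zero_le_two (by nlinarith)
    set q : ℝ := 2 / (n * (n - 1))
    have hs2 : 16 * ((k + 1 : ℕ) : ℝ) / n ^ 2 = e + 4 * s ^ 2 := by
      rw [he, hs]; push_cast; field_simp; ring
    rw [hs2, binCDF, binCDF, ← hb]
    have m1 : b (g - 1) * b h ≤ 1 := mul_le_one₀ (b1 _) (b0 _) (b1 _)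
    have m2 : b g * b (h - 1) ≤ 1 := mul_le_one₀ (b1 _) (b0 _) (b1 _)
    have m3 : b g * b h ≤ 1 := mul_le_one₀ (b1 _) (b0 _) (b1 _)
    have p1 : 0 ≤ b (g - 1) * b h := mul_nonneg (b0 _) (b0 _)
    have p2 : 0 ≤ b g * b (h - 1) := mul_nonneg (b0 _) (b0 _)
    have p3 : 0 ≤ b g * b h := mul_nonneg (b0 _) (b0 _)
    have p4 : 0 ≤ b (g - 1) * b (h - 1) := mul_nonneg (b0 _) (b0 _)
    nlinarith [mul_le_mul_of_nonneg_left m1 (sub_nonneg.2 hq),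
      mul_le_mul_of_nonneg_left m2 (sub_nonneg.2 hq), mul_nonneg (sub_nonneg.2 hq) p3,
      mul_nonneg (sq_nonneg s) p4]

/-- The second moment of the slow mass is governed by two walkers that start together. Each time
their common coordinate is picked they separate with probability `1 / 2`, and from then on they are
nearly independent. -/
lemma avgLists_slowMass_sq_le (hn : 2 ≤ n) (l m : ℕ) (j : Fin n) (g : ℤ) :
    avgLists (l + m) (fun L => slowMass j L g ^ 2)
      ≤ (1 - 1 / n) ^ m + binCDF (2 / n) l g ^ 2 + 16 * (l + m) / n ^ 2 := by
  have hn' : (2 : ℝ) ≤ n := by exact_mod_cast hn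
  have hs1 := two_div_le_one hn
  have hs0 : (0 : ℝ) ≤ 2 / n := by positivity
  have b0 := binCDF_nonneg hs0 hs1
  have b1 := binCDF_le_one hs0 hs1
  induction m generalizing j g with
  | zero =>
    have : avgLists (l + 0) (fun L => slowMass j L g ^ 2) ≤
        avgLists (l + 0) (fun _ : List (Fin n × Fin n) => (1 : ℝ)) :=
      avgLists_mono fun L => pow_le_one₀ (slowMass_nonneg _ _ _) (slowMass_le_one _ _ _)
    rw [avgLists_const hn] at this
    have : (0 : ℝ) ≤ 16 * (l + (0 : ℕ)) / n ^ 2 := by positivity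
    have := sq_nonneg (binCDF (2 / n) l g)
    rw [pow_zero]
    linarith
  | succ m ih =>
    set X : ℝ := (1 - 1 / n) ^ m with hX
    have hX0 : 0 ≤ X := by
      refine pow_nonneg (sub_nonneg.2 ?_) _
      rw [div_le_one (by linarith)]; linarith
    set e : ℝ := 16 * (l + m) / n ^ 2 with he
    set B : ℝ := binCDF (2 / n) l g ^ 2 with hB
    have hmono : binCDF (2 / n) l (g - 1) ^ 2 ≤ B :=
      pow_le_pow_left₀ (b0 _ _) (binCDF_pred_le hs0 hs1 l g) 2
    have key : ∀ q : Fin n × Fin n, q.1 ≠ q.2 →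
        avgLists (l + m) (fun L => slowMass j (q :: L) g ^ 2) ≤
        (X + B + e) + (-(X / 2)) * hit j q := by
      intro q hq
      by_cases hj : j = q.1 ∨ j = q.2
      · have e1 : (fun L => slowMass j (q :: L) g ^ 2) = fun L =>
            ((1 / 4) * slowMass q.1 L (g - 1) ^ 2 + (1 / 4) * slowMass q.2 L (g - 1) ^ 2)
              + (1 / 2) * (slowMass q.1 L (g - 1) * slowMass q.2 L (g - 1)) := by
          ext L
          rw [slowMass_cons_of_hit hq hj]; ring
        rw [e1, avgLists_add, avgLists_add, avgLists_const_mul, avgLists_const_mul,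
          avgLists_const_mul]
        have h1 := ih q.1 (g - 1)
        have h2 := ih q.2 (g - 1)
        have h3 := avgLists_slowMass_mul_le hn (l + m) hq (g - 1) (g - 1)
        have h4 : binCDF (2 / n) (l + m) (g - 1) ^ 2 ≤ binCDF (2 / n) l (g - 1) ^ 2 :=
          pow_le_pow_left₀ (b0 _ _) (binCDF_anti hs0 hs1 l m (g - 1)) 2
        push_cast at h3
        rw [← sq, ← he] at h3
        simp only [hit, if_pos hj]
        linarith
      · simp only [slowMass_cons_of_not_hit hj, hit, if_neg hj]
        have := ih j g
        linarith
    rw [← add_assoc, avgLists]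
    refine (avgPairs_mono key).trans ?_
    rw [avgPairs_add, avgPairs_const hn, avgPairs_const_mul, avgPairs_hit hn, pow_succ, ← hX]
    have : e ≤ 16 * (l + (m + 1 : ℕ)) / n ^ 2 := by
      rw [he]; gcongr; simp
    have e2 : X * (1 - 1 / n) = X + -(X / 2) * (2 / n) := by ring
    rw [e2]
    linarith

end Moments

/-! ### Lower and upper bounds for the distance -/

section Bounds

variable {n : ℕ}

/-- A coordinate that the walker can reach with a score of at most `g` carries a mass of at least
`2 ^ (-g)`. -/
lemma le_averageList_of_walk_ne_zero (L : List (Fin n × Fin n)) (j : Fin n) (g : ℤ) (i : Fin n)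
    (h : walk L (startAt j) g i ≠ 0) : (2 : ℝ) ^ (-g) ≤ averageList L (Pi.single j 1) i := by
  have gen : ∀ (L : List (Fin n × Fin n)) (y : ℤ → Fin n → ℝ) (x : Fin n → ℝ),
      (∀ i, 0 ≤ x i) → (∀ g i, y g i ≠ 0 → (2 : ℝ) ^ (-g) ≤ x i) →
      ∀ g i, walk L y g i ≠ 0 → (2 : ℝ) ^ (-g) ≤ averageList L x i := by
    intro L
    induction L with
    | nil => exact fun y x _ h => h
    | cons p L ih =>
      intro y x hx h
      refine ih _ _ (fun i => ?_) fun g i => ?_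
      · simp only [averagePair]
        split_ifs
        · linarith [hx p.1, hx p.2]
        · exact hx i
      · simp only [walkStep, averagePair]
        split_ifs
        · intro h0
          have h2 : (2 : ℝ) ^ (-(g - 1)) = 2 ^ (-g) * 2 := by
            rw [neg_sub, sub_eq_neg_add, zpow_add₀ two_ne_zero, zpow_one]
          have : y (g - 1) p.1 ≠ 0 ∨ y (g - 1) p.2 ≠ 0 := by
            by_contra hc
            push Not at hc
            simp [hc.1, hc.2] at h0
          rcases this with h1 | h1
          · linarith [h _ _ h1, hx p.2]
          · linarith [h _ _ h1, hx p.1]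
        · exact h g i
  refine gen L _ _ (fun i => ?_) (fun g i h0 => ?_) g i h
  · simp only [Pi.single_apply]; split_ifs <;> simp
  · simp only [startAt, ne_eq, ite_eq_right_iff, one_ne_zero, imp_false, not_not] at h0
    rw [h0.2, Pi.single_eq_same, zpow_neg]
    exact inv_le_one_of_one_le₀ (one_le_zpow₀ one_le_two h0.1)

/-- The coordinates reached with a low score are far above the mean, so that nearly all of the slow
mass counts in the distance, and once more in the deficit below the mean. -/
lemma slowMass_le_dist (hn : 2 ≤ n) (L : List (Fin n × Fin n)) (j : Fin n) (g : ℤ) :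
    2 * (1 - 2 ^ g / n) * slowMass j L g ≤ ∑ i, |averageList L (Pi.single j 1) i - 1 / n| := by
  have hn' : (2 : ℝ) ≤ n := by exact_mod_cast hn
  set x := averageList L (Pi.single j 1)
  have hsum : ∑ i, (x i - 1 / n) = 0 := by
    rw [Finset.sum_sub_distrib, sum_averageList]
    simp only [Finset.sum_pi_single', Finset.mem_univ, if_true, Finset.sum_const,
      Finset.card_univ, Fintype.card_fin, nsmul_eq_mul]
    field_simp
    ring
  have h : ∀ i, 2 * (1 - 2 ^ g / n) * walk L (startAt j) g i ≤
      |x i - 1 / n| + (x i - 1 / n) := by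
    intro i
    by_cases h0 : walk L (startAt j) g i = 0
    · rw [h0, mul_zero]
      linarith [neg_abs_le (x i - 1 / n)]
    · have h1 := le_averageList_of_walk_ne_zero L j g i h0
      have h2 : walk L (startAt j) g i ≤ x i := by
        change _ ≤ averageList L (Pi.single j 1) i
        rw [← walk_start_add L j g i]
        linarith [walk_nonneg L (startAbove_nonneg j) g i]
      have h3 := walk_nonneg L (startAt_nonneg j) g i
      have hg : (0 : ℝ) < 2 ^ g := by positivity
      have h4 : 1 / (n : ℝ) ≤ 2 ^ g / n * x i := by
        rw [div_mul_eq_mul_div]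
        gcongr
        calc (1 : ℝ) = 2 ^ g * 2 ^ (-g) := by rw [← zpow_add₀ two_ne_zero]; simp
          _ ≤ _ := by gcongr
      rcases le_total (2 ^ g / (n : ℝ)) 1 with h5 | h5
      · have : (1 - 2 ^ g / n) * walk L (startAt j) g i ≤ (1 - 2 ^ g / n) * x i :=
          mul_le_mul_of_nonneg_left h2 (by linarith)
        linarith [le_abs_self (x i - 1 / n)]
      · have : (1 - 2 ^ g / n) * walk L (startAt j) g i ≤ 0 :=
          mul_nonpos_of_nonpos_of_nonneg (by linarith) h3
        linarith [neg_abs_le (x i - 1 / n)]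
  calc _ = ∑ i, 2 * (1 - 2 ^ g / n) * walk L (startAt j) g i := by
        rw [slowMass, Finset.mul_sum]
    _ ≤ ∑ i, (|x i - 1 / n| + (x i - 1 / n)) := Finset.sum_le_sum fun i _ => h i
    _ = _ := by rw [Finset.sum_add_distrib, hsum, add_zero]

/-- By the convexity of the absolute value, averaging does not increase the distance. -/
lemma dist_averagePair_le (p : Fin n × Fin n) (x : Fin n → ℝ) (c : ℝ) :
    ∑ i, |averagePair p x i - c| ≤ ∑ i, |x i - c| := by
  by_cases hp : p.1 = p.2
  · refine (Finset.sum_congr rfl fun i _ => ?_).le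
    simp only [averagePair, hp]
    split_ifs with h
    · rcases h with h | h <;> rw [h, add_self_div_two]
    · rfl
  · have e : ∀ i, |averagePair p x i - c| =
        if i = p.1 ∨ i = p.2 then |(x p.1 + x p.2) / 2 - c| else |x i - c| := by
      intro i; simp only [averagePair]; split_ifs <;> rfl
    simp only [e]
    rw [sum_pair_ite hp _ fun i => |x i - c|]
    have : |(x p.1 + x p.2) / 2 - c| ≤ (|x p.1 - c| + |x p.2 - c|) / 2 := by
      rw [show (x p.1 + x p.2) / 2 - c = ((x p.1 - c) + (x p.2 - c)) / 2 by ring, abs_div,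
        abs_two]
      gcongr
      exact abs_add_le _ _
    linarith

lemma dist_averageList_le (L : List (Fin n × Fin n)) (x : Fin n → ℝ) (c : ℝ) :
    ∑ i, |averageList L x i - c| ≤ ∑ i, |x i - c| := by
  induction L generalizing x with
  | nil => exact le_rfl
  | cons p L ih => exact (ih _).trans (dist_averagePair_le p x c)

/-- For vectors of mean zero, an averaging step contracts the expected squared norm by a constant
factor. -/
lemma avgPairs_sum_averagePair_sq (hn : 2 ≤ n) (x : Fin n → ℝ) (hx : ∑ i, x i = 0) :
    avgPairs (fun q => ∑ i, averagePair q x i ^ 2) = (1 - 1 / (n - 1)) * ∑ i, x i ^ 2 := by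
  have hn' : (2 : ℝ) ≤ n := by exact_mod_cast hn
  have h1 : (n : ℝ) - 1 ≠ 0 := by linarith
  have key : ∀ q : Fin n × Fin n, q.1 ≠ q.2 → ∑ i, averagePair q x i ^ 2 =
      ∑ i, x i ^ 2 + ((-(1 / 2)) * (x q.1 ^ 2 + x q.2 ^ 2) + x q.1 * x q.2) := by
    intro q hq
    have e : ∀ i, averagePair q x i ^ 2 =
        if i = q.1 ∨ i = q.2 then ((x q.1 + x q.2) / 2) ^ 2 else x i ^ 2 := by
      intro i; simp only [averagePair]; split_ifs <;> rfl
    simp only [e]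
    rw [sum_pair_ite hq _ fun i => x i ^ 2]
    ring
  rw [avgPairs_congr key, avgPairs_add, avgPairs_const hn, avgPairs_add, avgPairs_const_mul,
    avgPairs_fst_add_snd hn (fun i => x i ^ 2), avgPairs_mul, hx]
  field_simp
  ring

lemma avgLists_sum_averageList_sq (hn : 2 ≤ n) (m : ℕ) (x : Fin n → ℝ) (hx : ∑ i, x i = 0) :
    avgLists m (fun L => ∑ i, averageList L x i ^ 2) = (1 - 1 / (n - 1)) ^ m * ∑ i, x i ^ 2 := by
  induction m generalizing x with
  | zero => simp [avgLists, averageList]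
  | succ m ih =>
    have : ∀ q, avgLists m (fun L => ∑ i, averageList (q :: L) x i ^ 2) =
        (1 - 1 / ((n : ℝ) - 1)) ^ m * ∑ i, averagePair q x i ^ 2 := fun q =>
      ih (averagePair q x) ((sum_averagePair x).trans hx)
    simp only [avgLists, this]
    rw [avgPairs_const_mul, avgPairs_sum_averagePair_sq hn x hx]
    ring

/-- The part of the mass with a score above `g` is spread out: two walkers with such scores share
a coordinate either because they never separated, which costs `2 ^ (-g - 1)`, or because they met
again, which has probability at most `1 / (n - 1)`. -/
lemma avgLists_sum_walk_sq_le (hn : 2 ≤ n) (k : ℕ) (j : Fin n) (g : ℤ) :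
    avgLists k (fun L => ∑ i, walk L (startAbove j) g i ^ 2) ≤ 2 ^ (-(g + 1)) + 1 / (n - 1) := by
  have hn' : (2 : ℝ) ≤ n := by exact_mod_cast hn
  have h1 : (0 : ℝ) < (n : ℝ) - 1 := by linarith
  induction k generalizing g with
  | zero =>
    have h2 : (0 : ℝ) < 1 / (n - 1) := by positivity
    simp only [avgLists, walk, List.foldl_nil, startAbove]
    by_cases hg : g < 0
    · have : (1 : ℝ) ≤ 2 ^ (-(g + 1)) := one_le_zpow₀ one_le_two (by omega)
      simp [hg]
      have h3 : (0 : ℝ) < ((n : ℝ) - 1)⁻¹ := by positivity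
      rw [neg_add_rev] at this
      linarith
    · have : (0 : ℝ) < 2 ^ (-(g + 1)) := by positivity
      simp [hg]
      rw [neg_add_rev] at this
      positivity
  | succ k ih =>
    have key : ∀ L : List (Fin n × Fin n),
        avgPairs (fun q => ∑ i, walk (L ++ [q]) (startAbove j) g i ^ 2) ≤
        ((1 - 2 / n) * ∑ i, walk L (startAbove j) g i ^ 2 +
          (1 / n) * ∑ i, walk L (startAbove j) (g - 1) i ^ 2) + 1 / (n * (n - 1)) := by
      intro L
      set u := walk L (startAbove j)
      have hu0 : ∀ i, 0 ≤ u (g - 1) i := walk_nonneg L (startAbove_nonneg j) (g - 1)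
      have hu1 : ∑ i, u (g - 1) i ≤ 1 := by
        have h : ∑ i, averageList L (Pi.single j 1) i = 1 := by
          rw [sum_averageList]; simp
        rw [← h]
        refine Finset.sum_le_sum fun i _ => ?_
        rw [← walk_start_add L j (g - 1) i]
        linarith [walk_nonneg L (startAt_nonneg j) (g - 1) i]
      have e : ∀ q : Fin n × Fin n, q.1 ≠ q.2 →
          ∑ i, walk (L ++ [q]) (startAbove j) g i ^ 2 = ∑ i, u g i ^ 2 +
          ((-1) * (u g q.1 ^ 2 + u g q.2 ^ 2) +
            ((1 / 2) * (u (g - 1) q.1 ^ 2 + u (g - 1) q.2 ^ 2) +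
              u (g - 1) q.1 * u (g - 1) q.2)) := by
        intro q hq
        have e : ∀ i, walk (L ++ [q]) (startAbove j) g i ^ 2 = if i = q.1 ∨ i = q.2 then
            ((u (g - 1) q.1 + u (g - 1) q.2) / 2) ^ 2 else u g i ^ 2 := by
          intro i
          rw [walk_append]
          simp only [walk, List.foldl_cons, List.foldl_nil, walkStep]
          split_ifs <;> rfl
        simp only [e]
        rw [sum_pair_ite hq _ fun i => u g i ^ 2]
        ring
      rw [avgPairs_congr e, avgPairs_add, avgPairs_const hn, avgPairs_add, avgPairs_const_mul,
        avgPairs_fst_add_snd hn (fun i => u g i ^ 2), avgPairs_add, avgPairs_const_mul,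
        avgPairs_fst_add_snd hn (fun i => u (g - 1) i ^ 2), avgPairs_mul]
      have h2 : ((∑ i, u (g - 1) i) ^ 2 - ∑ i, u (g - 1) i ^ 2) / (n * (n - 1)) ≤
          1 / ((n : ℝ) * (n - 1)) := by
        refine div_le_div_of_nonneg_right ?_ (by positivity)
        have : (∑ i, u (g - 1) i) ^ 2 ≤ 1 := pow_le_one₀ (Finset.sum_nonneg fun i _ => hu0 i) hu1
        have : 0 ≤ ∑ i, u (g - 1) i ^ 2 := Finset.sum_nonneg fun i _ => sq_nonneg _
        linarith
      refine le_of_sub_nonneg ((sub_nonneg.2 h2).trans (le_of_eq ?_))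
      ring
    rw [avgLists_append]
    refine (avgLists_mono key).trans ?_
    rw [avgLists_add, avgLists_add, avgLists_const_mul, avgLists_const_mul, avgLists_const hn]
    have i1 := mul_le_mul_of_nonneg_left (ih g) (sub_nonneg.2 (two_div_le_one hn))
    have i2 := mul_le_mul_of_nonneg_left (ih (g - 1)) (by positivity : (0 : ℝ) ≤ 1 / n)
    have e1 : (2 : ℝ) ^ (-(g - 1 + 1)) = 2 ^ (-(g + 1)) * 2 := by
      rw [show -(g - 1 + 1) = -(g + 1) + 1 by ring, zpow_add₀ two_ne_zero, zpow_one]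
    rw [e1] at i2
    refine (add_le_add (add_le_add i1 i2) le_rfl).trans (le_of_eq ?_)
    field_simp
    ring

/-- After `L`, split the mass according to the score. The slow part contributes at most twice its
mass to the distance, and the remaining part contributes at most its deviation from its mean. -/
lemma dist_append_le (hn : 2 ≤ n) (L L' : List (Fin n × Fin n)) (j : Fin n) (g : ℤ) :
    ∑ i, |averageList (L ++ L') (Pi.single j 1) i - 1 / n| ≤ 2 * slowMass j L g +
      √(n * ∑ i, averageList L' (fun i => walk L (startAbove j) g i -
        (∑ i, walk L (startAbove j) g i) / n) i ^ 2) := by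
  have hn' : (2 : ℝ) ≤ n := by exact_mod_cast hn
  set u := walk L (startAbove j) g
  set c := walk L (startAt j) g
  set w : Fin n → ℝ := fun i => u i - (∑ i, u i) / n
  set v : Fin n → ℝ := fun _ => (∑ i, u i) / n with hv
  have hc0 : ∀ i, 0 ≤ c i := walk_nonneg L (startAt_nonneg j) g
  have htot : ∑ i, c i + ∑ i, u i = 1 := by
    rw [← Finset.sum_add_distrib]
    have h : ∑ i, averageList L (Pi.single j 1) i = 1 := by
      rw [sum_averageList]; simp
    rw [← h]
    exact Finset.sum_congr rfl fun i _ => walk_start_add L j g i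
  have hdec : averageList L (Pi.single j 1) = (c + v) + w := by
    ext i
    rw [← walk_start_add L j g i]
    simp only [Pi.add_apply, w, v]
    ring
  have h1 : ∑ i, |averageList L' w i| ≤ √(n * ∑ i, averageList L' w i ^ 2) := by
    refine Real.le_sqrt_of_sq_le ?_
    have := sq_sum_le_card_mul_sum_sq (s := Finset.univ) (f := fun i => |averageList L' w i|)
    simpa using this
  have h2 : ∑ i, |averageList L' (c + v) i - 1 / n| ≤ 2 * ∑ i, c i := by
    refine (dist_averageList_le L' _ _).trans ?_
    have : ∀ i, |(c + v) i - 1 / n| ≤ c i + (∑ i, c i) / n := by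
      intro i
      have e : (c + v) i - 1 / n = c i - (∑ i, c i) / n := by
        rw [Pi.add_apply, ← htot, hv]; ring
      have : 0 ≤ (∑ i, c i) / n := div_nonneg (Finset.sum_nonneg fun i _ => hc0 i) (by positivity)
      rw [e, abs_le]
      constructor <;> linarith [hc0 i]
    refine (Finset.sum_le_sum fun i _ => this i).trans (le_of_eq ?_)
    simp only [Finset.sum_add_distrib, Finset.sum_const, Finset.card_univ, Fintype.card_fin,
      nsmul_eq_mul]
    field_simp
    ring
  rw [averageList_append, hdec, averageList_add]
  calc _ ≤ ∑ i, (|averageList L' (c + v) i - 1 / n| +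
        |averageList L' w i|) := by
        refine Finset.sum_le_sum fun i _ => ?_
        rw [Pi.add_apply, add_sub_right_comm]
        exact abs_add_le _ _
    _ ≤ _ := by
        rw [Finset.sum_add_distrib]
        exact add_le_add h2 h1

/-- The high score part of the mass after `k` steps is flattened by `m` further steps. -/
lemma avgLists_deviation_le (hn : 2 ≤ n) (k m : ℕ) (j : Fin n) (g : ℤ) :
    avgLists k (fun L => avgLists m fun L' =>
      n * ∑ i, averageList L' (fun i => walk L (startAbove j) g i -
        (∑ i, walk L (startAbove j) g i) / n) i ^ 2)
      ≤ n * ((1 - 1 / (n - 1)) ^ m * (2 ^ (-(g + 1)) + 1 / (n - 1))) := by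
  have hn' : (2 : ℝ) ≤ n := by exact_mod_cast hn
  have h1 : (0 : ℝ) ≤ 1 - 1 / ((n : ℝ) - 1) := by
    rw [sub_nonneg, div_le_one (by linarith)]; linarith
  have key : ∀ L : List (Fin n × Fin n), (avgLists m fun L' =>
      n * ∑ i, averageList L' (fun i => walk L (startAbove j) g i -
        (∑ i, walk L (startAbove j) g i) / n) i ^ 2) ≤
      n * ((1 - 1 / (n - 1)) ^ m * ∑ i, walk L (startAbove j) g i ^ 2) := by
    intro L
    set u := walk L (startAbove j) g
    rw [avgLists_const_mul, avgLists_sum_averageList_sq hn]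
    · refine mul_le_mul_of_nonneg_left (mul_le_mul_of_nonneg_left ?_ (pow_nonneg h1 m))
        (Nat.cast_nonneg n)
      have e : ∑ i, (u i - (∑ i, u i) / n) ^ 2 = ∑ i, u i ^ 2 - (∑ i, u i) ^ 2 / n := by
        simp only [sub_sq, Finset.sum_add_distrib, Finset.sum_sub_distrib, ← Finset.sum_mul,
          ← Finset.mul_sum, Finset.sum_const, Finset.card_univ, Fintype.card_fin, nsmul_eq_mul]
        field_simp
        ring
      rw [e]
      have : 0 ≤ (∑ i, u i) ^ 2 / n := by positivity
      linarith
    · simp only [Finset.sum_sub_distrib, Finset.sum_const, Finset.card_univ, Fintype.card_fin,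
        nsmul_eq_mul]
      field_simp
      ring
  refine (avgLists_mono key).trans ?_
  rw [avgLists_const_mul, avgLists_const_mul]
  gcongr
  exact avgLists_sum_walk_sq_le hn k j g

end Bounds

/-! ### The central limit theorem for the score -/

section CentralLimit

/-- The law of the number of successes in `k` independent trials of success probability `s`. -/
noncomputable def binLaw (s : ℝ) : ℕ → Measure ℝ
  | 0 => Measure.dirac 0
  | k + 1 => ENNReal.ofReal (1 - s) • binLaw s k + ENNReal.ofReal s • (binLaw s k).map (· + 1)

lemma isProbabilityMeasure_binLaw {s : ℝ} (h0 : 0 ≤ s) (h1 : s ≤ 1) (k : ℕ) :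
    IsProbabilityMeasure (binLaw s k) := by
  induction k with
  | zero => rw [binLaw]; infer_instance
  | succ k ih =>
    have := Measure.isProbabilityMeasure_map (μ := binLaw s k) (f := (· + 1)) (by fun_prop)
    constructor
    rw [binLaw, Measure.add_apply, Measure.smul_apply, Measure.smul_apply, measure_univ,
      measure_univ, smul_eq_mul, smul_eq_mul, mul_one, mul_one,
      ← ENNReal.ofReal_add (by linarith) h0]
    simp

lemma binLaw_Iic {s : ℝ} (h0 : 0 ≤ s) (h1 : s ≤ 1) (k : ℕ) (g : ℤ) :
    binLaw s k (Set.Iic (g : ℝ)) = ENNReal.ofReal (binCDF s k g) := by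
  induction k generalizing g with
  | zero =>
    rw [binLaw, Measure.dirac_apply' _ measurableSet_Iic, binCDF]
    by_cases h : 0 ≤ g <;> simp [h]
  | succ k ih =>
    have e : (fun x : ℝ => x + 1) ⁻¹' Set.Iic (g : ℝ) = Set.Iic ((g - 1 : ℤ) : ℝ) := by
      ext x; simp [le_sub_iff_add_le]
    rw [binLaw, Measure.add_apply, Measure.smul_apply, Measure.smul_apply,
      Measure.map_apply (by fun_prop) measurableSet_Iic, e, ih, ih, smul_eq_mul, smul_eq_mul,
      ← ENNReal.ofReal_mul (by linarith), ← ENNReal.ofReal_mul h0, ← ENNReal.ofReal_add, binCDF]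
    · exact mul_nonneg (by linarith) (binCDF_nonneg h0 h1 _ _)
    · exact mul_nonneg h0 (binCDF_nonneg h0 h1 _ _)

lemma charFun_binLaw {s : ℝ} (h0 : 0 ≤ s) (h1 : s ≤ 1) (k : ℕ) (t : ℝ) :
    charFun (binLaw s k) t = (1 + s * (Complex.exp (Complex.I * t) - 1)) ^ k := by
  induction k with
  | zero => simp [binLaw]
  | succ k ih =>
    have := isProbabilityMeasure_binLaw h0 h1 k
    have := Measure.isProbabilityMeasure_map (μ := binLaw s k) (f := (· + 1)) (by fun_prop)
    have hint : ∀ μ : Measure ℝ, IsProbabilityMeasure μ →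
        Integrable (fun x : ℝ => Complex.exp (t * x * Complex.I)) μ := by
      intro μ _
      refine Integrable.of_bound (C := 1) (by fun_prop) (ae_of_all _ fun x => ?_)
      rw [← Complex.ofReal_mul, Complex.norm_exp_ofReal_mul_I]
    have e := charFun_map_add_const (μ := binLaw s k) 1 t
    rw [ih] at e
    rw [charFun_apply_real] at ih e ⊢
    rw [binLaw, integral_add_measure, integral_smul_measure, integral_smul_measure, ih, e,
      ENNReal.toReal_ofReal (by linarith), ENNReal.toReal_ofReal h0, pow_succ]
    · simp only [Complex.real_smul, Real.inner_apply]
      push_cast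
      rw [show (1 : ℂ) * t * Complex.I = Complex.I * t by ring]
      ring
    · exact (hint _ inferInstance).smul_measure ENNReal.ofReal_ne_top
    · exact (hint _ inferInstance).smul_measure ENNReal.ofReal_ne_top

lemma norm_pow_sub_pow_le {a b : ℂ} (ha : ‖a‖ ≤ 1) (hb : ‖b‖ ≤ 1) (k : ℕ) :
    ‖a ^ k - b ^ k‖ ≤ k * ‖a - b‖ := by
  induction k with
  | zero => simp
  | succ k ih =>
    have e : a ^ (k + 1) - b ^ (k + 1) = a ^ k * (a - b) + (a ^ k - b ^ k) * b := by ring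
    rw [e]
    refine (norm_add_le _ _).trans ?_
    rw [norm_mul, norm_mul, norm_pow]
    have h1 : ‖a‖ ^ k * ‖a - b‖ ≤ 1 * ‖a - b‖ :=
      mul_le_mul_of_nonneg_right (pow_le_one₀ (norm_nonneg a) ha) (norm_nonneg _)
    have h2 : ‖a ^ k - b ^ k‖ * ‖b‖ ≤ ‖a ^ k - b ^ k‖ * 1 :=
      mul_le_mul_of_nonneg_left hb (norm_nonneg _)
    push_cast
    linarith

/-- The characteristic function of the centred and scaled number of successes tends to that of the
normal law of mean `a` and variance `1`. -/
lemma tendsto_charFun_binLaw {s σ : ℕ → ℝ} {k : ℕ → ℕ} {g : ℕ → ℤ} {a : ℝ}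
    (h0 : ∀ n, 0 ≤ s n) (h1 : ∀ n, s n ≤ 1) (hs : Tendsto s atTop (𝓝 0))
    (hσ : Tendsto σ atTop atTop) (hk : Tendsto (fun n => k n * s n / σ n ^ 2) atTop (𝓝 1))
    (hg : Tendsto (fun n => (k n * s n - g n) / σ n) atTop (𝓝 a)) (t : ℝ) :
    Tendsto (fun n => (1 + s n * (Complex.exp (Complex.I * ((t / σ n : ℝ) : ℂ)) - 1)) ^ k n *
      Complex.exp (-(Complex.I * ((t / σ n * g n : ℝ) : ℂ)))) atTop
      (𝓝 (Complex.exp (t * a * Complex.I - t ^ 2 / 2))) := by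
  set θ : ℕ → ℝ := fun n => t / σ n with hθ
  have hθ0 : Tendsto θ atTop (𝓝 0) := hσ.const_div_atTop t
  set E : ℕ → ℂ := fun n => Complex.exp (Complex.I * (θ n : ℂ)) with hE
  set w : ℕ → ℂ := fun n => s n * (E n - 1) with hw
  have hEn : ∀ n, ‖E n‖ = 1 := fun n => by
    rw [hE]; simp only; rw [mul_comm, Complex.norm_exp_ofReal_mul_I]
  have hwn : ∀ n, ‖w n‖ ≤ s n * |θ n| := fun n => by
    rw [hw]; simp only
    rw [norm_mul, Complex.norm_real, Real.norm_eq_abs, abs_of_nonneg (h0 n)]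
    exact mul_le_mul_of_nonneg_left Real.norm_exp_I_mul_ofReal_sub_one_le (h0 n)
  have hre : ∀ n, (w n).re ≤ 0 := fun n => by
    rw [hw]; simp only
    rw [Complex.re_ofReal_mul, Complex.sub_re, Complex.one_re]
    have : (E n).re ≤ 1 := (Complex.re_le_norm _).trans (hEn n).le
    exact mul_nonpos_of_nonneg_of_nonpos (h0 n) (by linarith)
  have hks : Tendsto (fun n => k n * s n * θ n ^ 2) atTop (𝓝 (t ^ 2)) := by
    have := hk.mul_const (t ^ 2)
    rw [one_mul] at this
    refine this.congr fun n => ?_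
    rw [hθ]; ring
  -- replacing the power by an exponential
  have hdiff : Tendsto (fun n => (1 + w n) ^ k n - Complex.exp (k n * w n)) atTop (𝓝 0) := by
    have hb : Tendsto (fun n => k n * s n * θ n ^ 2 * (s n * Real.exp (s n * |θ n|))) atTop
        (𝓝 (t ^ 2 * (0 * Real.exp (0 * |(0 : ℝ)|)))) :=
      hks.mul (hs.mul ((Real.continuous_exp.tendsto _).comp (hs.mul hθ0.abs)))
    rw [zero_mul, mul_zero] at hb
    refine squeeze_zero_norm (fun n => ?_) hb
    have n1 : ‖1 + w n‖ ≤ 1 := by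
      have e : 1 + w n = ((1 - s n : ℝ) : ℂ) + (s n : ℝ) * E n := by
        rw [hw]; push_cast; ring
      rw [e]
      refine (norm_add_le _ _).trans ?_
      rw [norm_mul, hEn, Complex.norm_real, Complex.norm_real, Real.norm_eq_abs,
        Real.norm_eq_abs, abs_of_nonneg (h0 n), abs_of_nonneg (sub_nonneg.2 (h1 n))]
      linarith
    have n2 : ‖Complex.exp (w n)‖ ≤ 1 := by
      rw [Complex.norm_exp]
      exact Real.exp_le_one_iff.2 (hre n)
    rw [Complex.exp_nat_mul]
    refine (norm_pow_sub_pow_le n1 n2 (k n)).trans ?_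
    have e := Complex.norm_exp_sub_sum_le_norm_mul_exp (w n) 2
    simp only [Finset.sum_range_succ, Finset.range_zero, Finset.sum_empty, pow_zero,
      Nat.factorial, Nat.cast_one, pow_one, zero_add, div_one, mul_one] at e
    rw [← norm_neg, neg_sub] at e
    have e2 : ‖w n‖ ^ 2 * Real.exp ‖w n‖ ≤ (s n * |θ n|) ^ 2 * Real.exp (s n * |θ n|) := by
      gcongr <;> exact hwn n
    calc (k n : ℝ) * ‖1 + w n - Complex.exp (w n)‖
        ≤ k n * ((s n * |θ n|) ^ 2 * Real.exp (s n * |θ n|)) := by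
          gcongr; exact e.trans e2
      _ = _ := by rw [mul_pow, sq_abs]; ring
  -- the exponent, by a third order expansion
  have hexp : Tendsto (fun n => k n * w n - Complex.I * ((θ n * g n : ℝ) : ℂ)) atTop
      (𝓝 (t * a * Complex.I - t ^ 2 / 2)) := by
    have hr : Tendsto (fun n => (k n : ℂ) * s n *
        (E n - (1 + Complex.I * θ n + (Complex.I * θ n) ^ 2 / 2))) atTop (𝓝 0) := by
      have hb : Tendsto (fun n => k n * s n * θ n ^ 2 * (|θ n| * Real.exp |θ n|)) atTop
          (𝓝 (t ^ 2 * (|(0 : ℝ)| * Real.exp |(0 : ℝ)|))) :=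
        hks.mul (hθ0.abs.mul ((Real.continuous_exp.tendsto _).comp hθ0.abs))
      rw [abs_zero, zero_mul, mul_zero] at hb
      refine squeeze_zero_norm (fun n => ?_) hb
      have e := Complex.norm_exp_sub_sum_le_norm_mul_exp (Complex.I * θ n) 3
      simp only [Finset.sum_range_succ, Finset.range_zero, Finset.sum_empty, pow_zero,
        Nat.factorial, Nat.cast_one, pow_one, zero_add, div_one, mul_one] at e
      norm_num at e
      rw [norm_mul, norm_mul, Complex.norm_natCast, Complex.norm_real, Real.norm_eq_abs,
        abs_of_nonneg (h0 n)]
      calc _ ≤ (k n : ℝ) * s n * (|θ n| ^ 3 * Real.exp |θ n|) :=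
            mul_le_mul_of_nonneg_left e (mul_nonneg (Nat.cast_nonneg _) (h0 n))
        _ = _ := by rw [pow_succ, sq_abs]; ring
    have h2 : Tendsto (fun n => (((k n * s n * θ n ^ 2 : ℝ)) : ℂ)) atTop (𝓝 ((t ^ 2 : ℝ) : ℂ)) :=
      (Complex.continuous_ofReal.tendsto _).comp hks
    have h3 : Tendsto (fun n => (((k n * s n - g n) / σ n : ℝ) : ℂ)) atTop (𝓝 (a : ℂ)) :=
      (Complex.continuous_ofReal.tendsto _).comp hg
    have := (hr.add (h2.const_mul (-1 / 2))).add (h3.const_mul (Complex.I * t))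
    refine (this.congr fun n => ?_).trans (le_of_eq ?_)
    · rw [hw, hθ]
      push_cast
      linear_combination (-(k n : ℂ) * s n * (t / σ n) ^ 2 / 2) * Complex.I_sq
    · congr 1; push_cast; ring
  have hfin : Tendsto (fun n => ((1 + w n) ^ k n - Complex.exp (k n * w n)) *
      Complex.exp (-(Complex.I * ((θ n * g n : ℝ) : ℂ))) +
      Complex.exp (k n * w n - Complex.I * ((θ n * g n : ℝ) : ℂ))) atTop
      (𝓝 (0 + Complex.exp (t * a * Complex.I - t ^ 2 / 2))) := by
    refine Tendsto.add ?_ ((Complex.continuous_exp.tendsto _).comp hexp)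
    refine squeeze_zero_norm (fun n => ?_) (tendsto_zero_iff_norm_tendsto_zero.1 hdiff)
    rw [norm_mul, show -(Complex.I * ((θ n * g n : ℝ) : ℂ)) =
      ((-(θ n * g n) : ℝ) : ℂ) * Complex.I by push_cast; ring, Complex.norm_exp_ofReal_mul_I,
      mul_one]
  rw [zero_add] at hfin
  refine hfin.congr fun n => ?_
  rw [sub_eq_add_neg ((k n : ℂ) * w n), Complex.exp_add]
  ring

/-- A triangular array version of the theorem of de Moivre and Laplace. -/
lemma tendsto_binCDF {s σ : ℕ → ℝ} {k : ℕ → ℕ} {g : ℕ → ℤ} {a : ℝ}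
    (h0 : ∀ n, 0 ≤ s n) (h1 : ∀ n, s n ≤ 1) (hs : Tendsto s atTop (𝓝 0))
    (hσ : Tendsto σ atTop atTop) (hk : Tendsto (fun n => k n * s n / σ n ^ 2) atTop (𝓝 1))
    (hg : Tendsto (fun n => (k n * s n - g n) / σ n) atTop (𝓝 a)) :
    Tendsto (fun n => binCDF (s n) (k n) (g n)) atTop (𝓝 (stdNormalCDF (-a))) := by
  have hP := fun n => isProbabilityMeasure_binLaw (h0 n) (h1 n) (k n)
  have hP1 := fun n => Measure.isProbabilityMeasure_map (μ := binLaw (s n) (k n))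
    (f := (· + (-(g n) : ℝ))) (by fun_prop)
  have hP2 := fun n => Measure.isProbabilityMeasure_map
    (μ := (binLaw (s n) (k n)).map (· + (-(g n) : ℝ))) (f := ((σ n)⁻¹ * ·)) (by fun_prop)
  set μ : ℕ → ProbabilityMeasure ℝ := fun n =>
    ⟨((binLaw (s n) (k n)).map (· + (-(g n) : ℝ))).map ((σ n)⁻¹ * ·), hP2 n⟩ with hμ
  set ν : ProbabilityMeasure ℝ := ⟨gaussianReal a 1, inferInstance⟩ with hν
  have hlim : Tendsto μ atTop (𝓝 ν) := by
    refine ProbabilityMeasure.tendsto_of_tendsto_charFun fun t => ?_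
    rw [hν, hμ]
    simp only [ProbabilityMeasure.coe_mk]
    rw [charFun_gaussianReal]
    have := tendsto_charFun_binLaw h0 h1 hs hσ hk hg t
    refine (this.congr fun n => ?_).trans (le_of_eq ?_)
    · rw [charFun_map_mul, charFun_map_add_const, charFun_binLaw (h0 n) (h1 n),
        show (σ n)⁻¹ * t = t / σ n by ring]
      simp only [Real.inner_apply]
      congr 2
      push_cast
      ring
    · congr 2; simp
  have hset := ProbabilityMeasure.tendsto_measure_of_null_frontier_of_tendsto' hlim
    (E := Set.Iic 0) (by
      have : NullSingletonClass (gaussianReal a 1) := nullSingletonClass_gaussianReal one_ne_zero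
      rw [frontier_Iic, hν, ProbabilityMeasure.coe_mk]
      exact measure_singleton 0)
  have hval : (ν : Measure ℝ) (Set.Iic 0) = ENNReal.ofReal (stdNormalCDF (-a)) := by
    rw [stdNormalCDF, ofReal_cdf, hν, ProbabilityMeasure.coe_mk]
    have e : gaussianReal a 1 = (gaussianReal 0 1).map (· + a) := by
      rw [gaussianReal_map_add_const, zero_add]
    rw [e, Measure.map_apply (by fun_prop) measurableSet_Iic]
    congr 1
    ext x
    simp [le_neg_iff_add_nonpos_right]
  rw [hval] at hset
  have hreal := (ENNReal.tendsto_toReal ENNReal.ofReal_ne_top).comp hset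
  rw [ENNReal.toReal_ofReal (show 0 ≤ stdNormalCDF (-a) from cdf_nonneg _ _)] at hreal
  refine hreal.congr' ?_
  filter_upwards [hσ.eventually_gt_atTop 0] with n hn
  have e : (μ n : Measure ℝ) (Set.Iic 0) = ENNReal.ofReal (binCDF (s n) (k n) (g n)) := by
    rw [← binLaw_Iic (h0 n) (h1 n), hμ]
    simp only [ProbabilityMeasure.coe_mk]
    rw [Measure.map_apply (by fun_prop) measurableSet_Iic,
      Measure.map_apply (by fun_prop) (measurableSet_preimage (by fun_prop) measurableSet_Iic)]
    congr 1
    ext x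
    have : 0 < (σ n)⁻¹ := inv_pos.2 hn
    simp only [Set.mem_preimage, Set.mem_Iic]
    rw [mul_nonpos_iff_pos_imp_nonpos]
    constructor
    · intro h; linarith [h.1 this]
    · intro h; exact ⟨fun _ => by linarith, fun _ => this.le⟩
  rw [Function.comp_apply, e, ENNReal.toReal_ofReal (binCDF_nonneg (h0 n) (h1 n) _ _)]

end CentralLimit

/-! ### From the random pairs to finite averages -/

section Link

variable {n : ℕ} {Ω : Type*} [MeasurableSpace Ω] {P : Measure Ω}
  {p : ℕ → Ω → Fin n × Fin n}

lemma IsUniformPairs.shift (hp : IsUniformPairs P p) : IsUniformPairs P fun k => p (k + 1) where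
  measurable k := hp.measurable (k + 1)
  indep := hp.indep.precomp (g := fun k => k + 1) (add_left_injective 1)
  law k := hp.law (k + 1)

lemma IsUniformPairs.real_preimage_singleton (hp : IsUniformPairs P p) (k : ℕ)
    (q : Fin n × Fin n) :
    P.real (p k ⁻¹' {q}) = if q.1 ≠ q.2 then 1 / ((n : ℝ) * (n - 1)) else 0 := by
  classical
  have e : {q : Fin n × Fin n | q.1 ≠ q.2} =
      ((Finset.univ.filter fun q : Fin n × Fin n => q.1 ≠ q.2 : Finset _) : Set _) := by
    ext; simp
  have hcard : ((Finset.univ.filter fun q : Fin n × Fin n => q.1 ≠ q.2).card : ℝ) =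
      n * (n - 1) := by
    have := sum_distinct fun _ : Fin n × Fin n => (1 : ℝ)
    simp only [Finset.sum_const, nsmul_eq_mul, mul_one, Finset.card_univ, Fintype.card_fin] at this
    rw [this]; ring
  rw [← map_measureReal_apply (hp.measurable k) (measurableSet_singleton q), hp.law k, e,
    ← Finset.coe_singleton, measureReal_def, uniformOn_apply_finset, ENNReal.toReal_div,
    ENNReal.toReal_natCast, ENNReal.toReal_natCast, hcard]
  by_cases h : q.1 = q.2
  · rw [Finset.inter_singleton_of_notMem (by simp [h])]; simp [h]
  · rw [Finset.inter_singleton_of_mem (by simp [h])]; simp [h]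

/-- Expectations of functions of the first `k` pairs are averages over lists. -/
lemma IsUniformPairs.integral_eq_avgLists [IsProbabilityMeasure P] (hp : IsUniformPairs P p) (k : ℕ)
    (F : List (Fin n × Fin n) → ℝ) :
    ∫ ω, F ((List.range k).map fun j => p j ω) ∂P = avgLists k F := by
  induction k generalizing p F with
  | zero => simp [avgLists]
  | succ k ih =>
    -- The first pair is independent of the other ones; sum over its possible values.
    let S : Finset ℕ := {0}
    let U : Finset ℕ := Finset.Icc 1 k
    have hind : IndepFun (fun ω (i : S) => p i ω) (fun ω (i : U) => p i ω) P :=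
      hp.indep.indepFun_finset S U (by simp [S, U]) hp.measurable
    have hmS : Measurable fun ω (i : S) => p i ω := measurable_pi_lambda _ fun i => hp.measurable i
    have hmU : Measurable fun ω (i : U) => p i ω := measurable_pi_lambda _ fun i => hp.measurable i
    let ψ (q : Fin n × Fin n) (v : U → Fin n × Fin n) : ℝ :=
      F (q :: (List.range k).map fun j => if h : j + 1 ∈ U then v ⟨j + 1, h⟩ else q)
    let φ (q : Fin n × Fin n) (v : S → Fin n × Fin n) : ℝ :=
      if v ⟨0, by simp [S]⟩ = q then 1 else 0
    have hψ : ∀ q ω, ψ q (fun i : U => p i ω) =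
        F (q :: (List.range k).map fun j => p (j + 1) ω) := by
      intro q ω
      simp only [ψ]
      congr 2
      refine List.map_congr_left fun j hj => ?_
      rw [dif_pos (by simpa [U] using hj)]
    have hsplit : ∀ ω, F ((List.range (k + 1)).map fun j => p j ω) =
        ∑ q, φ q (fun i : S => p i ω) * ψ q (fun i : U => p i ω) := by
      intro ω
      simp only [φ, ite_mul, one_mul, zero_mul, Finset.sum_ite_eq, Finset.mem_univ, if_true, hψ]
      rw [List.range_succ_eq_map, List.map_cons, List.map_map]
      rfl
    have hint : ∀ q, Integrable (fun ω => φ q (fun i : S => p i ω) * ψ q (fun i : U => p i ω)) P := by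
      intro q
      have h1 : Integrable (fun ω => ψ q fun i : U => p i ω) P :=
        have : IsProbabilityMeasure (P.map fun ω (i : U) => p i ω) :=
          Measure.isProbabilityMeasure_map hmU.aemeasurable
        (Integrable.of_finite (f := ψ q)).comp_measurable hmU
      refine h1.bdd_mul (c := 1) ?_ (ae_of_all _ fun ω => ?_)
      · exact ((Measurable.of_discrete (f := φ q)).comp hmS).aestronglyMeasurable
      · simp only [φ]; split_ifs <;> simp
    simp only [hsplit]
    rw [integral_finsetSum _ fun q _ => hint q, avgLists, avgPairs, Finset.sum_div,
      Finset.sum_filter]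
    refine Finset.sum_congr rfl fun q _ => ?_
    rw [hind.integral_fun_comp_mul_comp (f := φ q) (g := ψ q)
      hmS.aemeasurable hmU.aemeasurable
      (Measurable.of_discrete).aestronglyMeasurable (Measurable.of_discrete).aestronglyMeasurable]
    simp only [hψ]
    rw [ih hp.shift fun L => F (q :: L)]
    have e : ∫ ω, φ q (fun i : S => p i ω) ∂P = P.real (p 0 ⁻¹' {q}) := by
      rw [← integral_indicator_one (hp.measurable 0 (measurableSet_singleton q))]
      refine integral_congr_ae (ae_of_all _ fun ω => ?_)
      by_cases h : p 0 ω = q <;> simp [φ, Set.indicator, h]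
    rw [e, hp.real_preimage_singleton]
    split_ifs <;> ring

lemma chain_eq_averageList (x : Fin n → ℝ) (q : ℕ → Fin n × Fin n) (k : ℕ) :
    chain x q k = averageList ((List.range k).map q) x := by
  induction k with
  | zero => rfl
  | succ k ih =>
    rw [List.range_succ, List.map_append, averageList_append, ← ih]
    rfl

lemma T_eq [NeZero n] (q : ℕ → Fin n × Fin n) (k : ℕ) :
    T q k = ∑ i, |averageList ((List.range k).map q) (Pi.single 0 1) i - 1 / n| := by
  have e : firstUnit n = Pi.single 0 1 := by
    ext i; simp only [firstUnit, Pi.single_apply, Fin.ext_iff, Fin.val_zero]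
  have e2 : mean (firstUnit n) = 1 / n := by
    rw [e, mean]; simp
  rw [T, e2, chain_eq_averageList, e]

end Link

/-! ### The mean square limit of the distance -/

section MeanSquare

variable {n : ℕ}

lemma avgLists_slowMass_sub_sq_le (hn : 2 ≤ n) (l m : ℕ) (j : Fin n) (g : ℤ) (c : ℝ) :
    avgLists (l + m) (fun L => (slowMass j L g - c) ^ 2) ≤ (1 - 1 / n) ^ m +
      binCDF (2 / n) l g ^ 2 + 16 * (l + m) / n ^ 2 - 2 * c * binCDF (2 / n) (l + m) g + c ^ 2 := by
  have e : (fun L => (slowMass j L g - c) ^ 2) =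
      fun L => (slowMass j L g ^ 2 + (-(2 * c)) * slowMass j L g) + c ^ 2 := by
    ext L; ring
  rw [e, avgLists_add, avgLists_add, avgLists_const_mul, avgLists_const hn,
    avgLists_slowMass hn]
  linarith [avgLists_slowMass_sq_le hn l m j g]

/-- If the slow mass is close to `c`, both at the current time and `m` steps earlier, then the
distance is close to `2 * c`. -/
lemma avgLists_dist_sub_sq_le (hn : 2 ≤ n) (l m : ℕ) (j : Fin n) (g : ℤ) (c : ℝ) :
    avgLists (l + m + m)
      (fun L => (∑ i, |averageList L (Pi.single j 1) i - 1 / n| - 2 * c) ^ 2) ≤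
    16 * ((1 - 1 / n) ^ m + binCDF (2 / n) (l + m) g ^ 2 + 16 * (l + m + m) / n ^ 2
        - 2 * c * binCDF (2 / n) (l + m + m) g + c ^ 2) +
      16 * ((1 - 1 / n) ^ m + binCDF (2 / n) l g ^ 2 + 16 * (l + m) / n ^ 2
        - 2 * c * binCDF (2 / n) (l + m) g + c ^ 2) +
      16 * (2 ^ g / n) ^ 2 +
      4 * (n * ((1 - 1 / (n - 1)) ^ m * (2 ^ (-(g + 1)) + 1 / (n - 1)))) := by
  set R : List (Fin n × Fin n) → List (Fin n × Fin n) → ℝ := fun L L' =>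
    n * ∑ i, averageList L' (fun i => walk L (startAbove j) g i -
        (∑ i, walk L (startAbove j) g i) / n) i ^ 2 with hR
  have hR0 : ∀ L L', 0 ≤ R L L' := fun L L' => by
    simp only [hR]
    exact mul_nonneg (Nat.cast_nonneg n) (Finset.sum_nonneg fun i _ => sq_nonneg _)
  have key : ∀ L L' : List (Fin n × Fin n),
      (∑ i, |averageList (L ++ L') (Pi.single j 1) i - 1 / n| - 2 * c) ^ 2 ≤
      ((16 * (slowMass j (L ++ L') g - c) ^ 2 + 16 * (slowMass j L g - c) ^ 2) +
        16 * (2 ^ g / n) ^ 2) + 4 * R L L' := by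
    intro L L'
    have h1 := slowMass_le_dist hn (L ++ L') j g
    have h2 := dist_append_le hn L L' j g
    change _ ≤ 2 * slowMass j L g + √(R L L') at h2
    have hs := Real.sq_sqrt (hR0 L L')
    have hη : (0 : ℝ) ≤ 2 ^ g / n := by positivity
    have hQ := slowMass_le_one j (L ++ L') g
    set d := ∑ i, |averageList (L ++ L') (Pi.single j 1) i - 1 / n|
    set Q := slowMass j (L ++ L') g
    set Q₁ := slowMass j L g
    set η : ℝ := 2 ^ g / n
    set ρ := √(R L L')
    rw [← hs]
    -- the upper bound on `d` controls positive deviations, and the lower bound negative ones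
    rcases le_total 0 (d - 2 * c) with h | h
    · have : (d - 2 * c) ^ 2 ≤ (2 * (Q₁ - c) + ρ) ^ 2 := pow_le_pow_left₀ h (by linarith) 2
      nlinarith [sq_nonneg (2 * (Q₁ - c) - ρ), sq_nonneg (Q - c), sq_nonneg η,
        sq_nonneg (Q₁ - c), sq_nonneg ρ]
    · have h3 : 2 * c - d ≤ 2 * η - 2 * (Q - c) := by
        nlinarith [mul_le_mul_of_nonneg_left hQ hη]
      have : (2 * c - d) ^ 2 ≤ (2 * η - 2 * (Q - c)) ^ 2 := pow_le_pow_left₀ (by linarith) h3 2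
      nlinarith [sq_nonneg (2 * η + 2 * (Q - c)), sq_nonneg (Q - c), sq_nonneg η,
        sq_nonneg (Q₁ - c), sq_nonneg ρ]
  rw [avgLists_append]
  refine (avgLists_mono fun L => avgLists_mono fun L' => key L L').trans ?_
  simp only [avgLists_add, avgLists_const_mul, avgLists_const hn]
  have h1 := avgLists_slowMass_sub_sq_le hn (l + m) m j g c
  rw [avgLists_append] at h1
  have h2 := avgLists_slowMass_sub_sq_le hn l m j g c
  have h3 := avgLists_deviation_le hn (l + m) m j g
  push_cast at h1
  change avgLists (l + m) (fun L => avgLists m fun L' => R L L') ≤ _ at h3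
  linarith

end MeanSquare

section Asymptotics

lemma tendsto_logb_natCast : Tendsto (fun n : ℕ => Real.logb 2 n) atTop atTop :=
  (Real.tendsto_logb_atTop one_lt_two).comp tendsto_natCast_atTop_atTop

/-- A margin for the score: large, but negligible against the fluctuations `√(log₂ n)`. -/
noncomputable def margin (n : ℕ) : ℝ := √√(Real.logb 2 n)

/-- A score slightly below `log₂ n`, at which the walker's mass `2 ^ (-g)` is still much larger
than the mean `1 / n`. -/
noncomputable def scoreLevel (n : ℕ) : ℤ := ⌊Real.logb 2 n - margin n⌋

/-- A number of steps that flattens mass spread over pieces of size `2 ^ (margin n) / n`, but is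
negligible against the window `n * √(log₂ n)`. -/
noncomputable def mixSteps (n : ℕ) : ℕ := ⌈n * margin n⌉₊

lemma tendsto_sqrt_logb : Tendsto (fun n : ℕ => √(Real.logb 2 n)) atTop atTop :=
  Real.tendsto_sqrt_atTop.comp tendsto_logb_natCast

lemma tendsto_margin : Tendsto margin atTop atTop :=
  Real.tendsto_sqrt_atTop.comp tendsto_sqrt_logb

lemma margin_nonneg (n : ℕ) : 0 ≤ margin n := Real.sqrt_nonneg _

lemma scoreLevel_le (n : ℕ) : (scoreLevel n : ℝ) ≤ Real.logb 2 n - margin n := Int.floor_le _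

lemma lt_scoreLevel_add_one (n : ℕ) : Real.logb 2 n - margin n < scoreLevel n + 1 :=
  Int.lt_floor_add_one _

lemma tendsto_margin_div : Tendsto (fun n => margin n / √(Real.logb 2 n)) atTop (𝓝 0) := by
  refine (tendsto_inv_atTop_zero.comp tendsto_margin).congr fun n => ?_
  have h : √(Real.logb 2 n) = margin n * margin n := (Real.mul_self_sqrt (Real.sqrt_nonneg _)).symm
  rw [h, div_self_mul_self']
  rfl

lemma tendsto_div_sqrt_logb_of_le {f : ℕ → ℝ} {C : ℝ}
    (hf : ∀ᶠ n in atTop, 0 ≤ f n ∧ f n ≤ 2 * margin n + C) :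
    Tendsto (fun n => f n / √(Real.logb 2 n)) atTop (𝓝 0) := by
  have h := (tendsto_margin_div.const_mul 2).add (tendsto_sqrt_logb.const_div_atTop C)
  rw [mul_zero, add_zero] at h
  refine tendsto_of_tendsto_of_tendsto_of_le_of_le' tendsto_const_nhds h ?_ ?_
  · filter_upwards [hf] with n hn
    exact div_nonneg hn.1 (Real.sqrt_nonneg _)
  · filter_upwards [hf] with n hn
    rw [← mul_div_assoc, ← add_div]
    exact div_le_div_of_nonneg_right hn.2 (Real.sqrt_nonneg _)

lemma tendsto_mixSteps_div :
    Tendsto (fun n : ℕ => 2 / n * (mixSteps n : ℝ) / √(Real.logb 2 n)) atTop (𝓝 0) := by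
  refine tendsto_div_sqrt_logb_of_le (C := 2) ?_
  filter_upwards [eventually_ge_atTop 2] with n hn
  have hn' : (2 : ℝ) ≤ n := by exact_mod_cast hn
  refine ⟨by positivity, ?_⟩
  have h1 : (mixSteps n : ℝ) ≤ n * margin n + 1 :=
    (Nat.ceil_lt_add_one (mul_nonneg (Nat.cast_nonneg n) (margin_nonneg n))).le
  calc (2 : ℝ) / n * mixSteps n ≤ 2 / n * (n * margin n + 1) := by gcongr
    _ = 2 * margin n + 2 / n := by field_simp
    _ ≤ 2 * margin n + 2 := by
      have := two_div_le_one hn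
      linarith

variable {k : ℕ → ℕ} {a : ℝ}

lemma tendsto_mul_div_logb
    (hk : Tendsto (fun n : ℕ => (2 / n * k n - Real.logb 2 n) / √(Real.logb 2 n)) atTop (𝓝 a)) :
    Tendsto (fun n : ℕ => 2 / n * k n / Real.logb 2 n) atTop (𝓝 1) := by
  have h := (hk.mul (tendsto_inv_atTop_zero.comp tendsto_sqrt_logb)).add_const 1
  rw [mul_zero, zero_add] at h
  refine h.congr' ?_
  filter_upwards [tendsto_logb_natCast.eventually_gt_atTop 0] with n hn
  have e : Real.logb 2 n = √(Real.logb 2 n) * √(Real.logb 2 n) := (Real.mul_self_sqrt hn.le).symm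
  have hs : √(Real.logb 2 n) ≠ 0 := (Real.sqrt_pos.2 hn).ne'
  rw [Function.comp_apply, ← div_eq_mul_inv, div_div, ← e, sub_div, div_self hn.ne']
  ring

lemma tendsto_binCDF_scoreLevel
    (hk : Tendsto (fun n : ℕ => (2 / n * k n - Real.logb 2 n) / √(Real.logb 2 n)) atTop (𝓝 a)) :
    Tendsto (fun n : ℕ => binCDF (2 / n) (k n) (scoreLevel n)) atTop (𝓝 (stdNormalCDF (-a))) := by
  -- the truncation makes the success probability admissible for all `n`, including `n = 1`
  have hs : ∀ᶠ n : ℕ in atTop, min 1 ((2 : ℝ) / n) = 2 / n := by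
    filter_upwards [eventually_ge_atTop 2] with n hn
    exact min_eq_right (two_div_le_one hn)
  have h := tendsto_binCDF (s := fun n : ℕ => min 1 ((2 : ℝ) / n))
    (σ := fun n : ℕ => √(Real.logb 2 n)) (k := k) (g := scoreLevel) (a := a)
    (fun n => le_min zero_le_one (by positivity)) (fun n => min_le_left _ _)
    ((tendsto_const_div_atTop_nhds_zero_nat 2).congr' (hs.mono fun n hn => hn.symm))
    tendsto_sqrt_logb ?_ ?_
  · refine h.congr' ?_
    filter_upwards [hs] with n hn
    rw [hn]
  · refine (tendsto_mul_div_logb hk).congr' ?_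
    filter_upwards [hs, tendsto_logb_natCast.eventually_gt_atTop 0] with n hn hL
    rw [hn, Real.sq_sqrt hL.le, mul_comm]
  · have h2 := hk.add (tendsto_div_sqrt_logb_of_le (C := 1)
      (f := fun n : ℕ => Real.logb 2 n - scoreLevel n) (Eventually.of_forall fun n => ?_))
    · rw [add_zero] at h2
      refine h2.congr' ?_
      filter_upwards [hs] with n hn
      rw [hn, ← add_div, mul_comm]
      congr 1
      ring
    · have h1 := scoreLevel_le n
      have h2 := lt_scoreLevel_add_one n
      have h3 := margin_nonneg n
      constructor <;> linarith

lemma tendsto_add_mixSteps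
    (hk : Tendsto (fun n : ℕ => (2 / n * k n - Real.logb 2 n) / √(Real.logb 2 n)) atTop (𝓝 a)) :
    Tendsto (fun n : ℕ => (2 / n * (k n + mixSteps n : ℕ) - Real.logb 2 n) / √(Real.logb 2 n))
      atTop (𝓝 a) := by
  have h2 := hk.add tendsto_mixSteps_div
  rw [add_zero] at h2
  refine h2.congr fun n => ?_
  rw [← add_div]
  push_cast
  congr 1
  ring

lemma tendsto_sixteen_mul_div_sq
    (hk : Tendsto (fun n : ℕ => (2 / n * k n - Real.logb 2 n) / √(Real.logb 2 n)) atTop (𝓝 a)) :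
    Tendsto (fun n : ℕ => 16 * (k n : ℝ) / n ^ 2) atTop (𝓝 0) := by
  have hlog : Tendsto (fun n : ℕ => Real.logb 2 n / n) atTop (𝓝 0) := by
    have h := (Real.isLittleO_log_id_atTop.tendsto_div_nhds_zero.comp
      tendsto_natCast_atTop_atTop).div_const (Real.log 2)
    rw [zero_div] at h
    refine h.congr fun n => ?_
    simp only [Function.comp_apply, id, Real.logb]
    ring
  have h := ((tendsto_mul_div_logb hk).mul hlog).const_mul 8
  rw [one_mul, mul_zero] at h
  refine h.congr' ?_
  filter_upwards [tendsto_logb_natCast.eventually_gt_atTop 0] with n hn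
  field_simp
  ring

lemma one_sub_one_div_pow_mixSteps_le {n : ℕ} {x : ℝ} (hx : 1 ≤ x) (hxn : x ≤ n) :
    (1 - 1 / x) ^ mixSteps n ≤ Real.exp (-margin n) := by
  have h0 : (0 : ℝ) ≤ 1 - 1 / x := by
    rw [sub_nonneg, div_le_one (by linarith)]; exact hx
  have h1 : n * margin n ≤ mixSteps n := Nat.le_ceil _
  have h2 : margin n ≤ mixSteps n * (1 / x) := by
    rw [mul_one_div, le_div_iff₀ (by linarith)]
    nlinarith [margin_nonneg n]
  calc (1 - 1 / x) ^ mixSteps n ≤ Real.exp (-(1 / x)) ^ mixSteps n :=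
        pow_le_pow_left₀ h0 (Real.one_sub_le_exp_neg _) _
    _ = Real.exp (-(mixSteps n * (1 / x))) := by rw [← Real.exp_nat_mul]; ring_nf
    _ ≤ _ := Real.exp_le_exp.2 (neg_le_neg h2)

lemma two_rpow_logb_natCast {n : ℕ} (hn : 2 ≤ n) : (2 : ℝ) ^ (Real.logb 2 n) = n :=
  Real.rpow_logb two_pos (by norm_num) (by positivity)

/-- The distance is close to `2 Φ(-a)` in mean square at times
`n (log₂ n + (a + o(1)) √(log₂ n)) / 2`. -/
lemma exists_meanSquare_bound {l : ℕ → ℕ}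
    (hl : Tendsto (fun n : ℕ => (2 / n * l n - Real.logb 2 n) / √(Real.logb 2 n)) atTop (𝓝 a)) :
    ∃ B : ℕ → ℝ, Tendsto B atTop (𝓝 0) ∧ ∀ n, 2 ≤ n → ∀ j : Fin n,
      avgLists (l n + mixSteps n + mixSteps n) (fun L =>
        (∑ i, |averageList L (Pi.single j 1) i - 1 / n| - 2 * stdNormalCDF (-a)) ^ 2) ≤ B n := by
  have hl1 := tendsto_add_mixSteps hl
  have hl2 := tendsto_add_mixSteps hl1
  set c := stdNormalCDF (-a)
  have hb0 := tendsto_binCDF_scoreLevel hl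
  have hb1 := tendsto_binCDF_scoreLevel hl1
  have hb2 := tendsto_binCDF_scoreLevel hl2
  have hexp : Tendsto (fun n => Real.exp (-margin n)) atTop (𝓝 0) :=
    Real.tendsto_exp_neg_atTop_nhds_zero.comp tendsto_margin
  -- `n * 2 ^ (-g - 1)` is at most `2 ^ margin n`, and mixing gains the larger factor `e ^ margin n`
  have hlog2 : 0 < 1 - Real.log 2 := by linarith [Real.log_two_lt_d9]
  have hη : Tendsto (fun n => Real.exp (-(Real.log 2 * margin n))) atTop (𝓝 0) :=
    Real.tendsto_exp_neg_atTop_nhds_zero.comp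
      (tendsto_margin.const_mul_atTop (Real.log_pos one_lt_two))
  have hη' : Tendsto (fun n => Real.exp (-((1 - Real.log 2) * margin n))) atTop (𝓝 0) :=
    Real.tendsto_exp_neg_atTop_nhds_zero.comp (tendsto_margin.const_mul_atTop hlog2)
  refine ⟨fun n =>
    16 * (Real.exp (-margin n) + binCDF (2 / n) (l n + mixSteps n) (scoreLevel n) ^ 2
      + 16 * ((l n + mixSteps n + mixSteps n : ℕ) : ℝ) / n ^ 2
        - 2 * c * binCDF (2 / n) (l n + mixSteps n + mixSteps n) (scoreLevel n) + c ^ 2) +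
      16 * (Real.exp (-margin n) + binCDF (2 / n) (l n) (scoreLevel n) ^ 2
        + 16 * ((l n + mixSteps n : ℕ) : ℝ) / n ^ 2
        - 2 * c * binCDF (2 / n) (l n + mixSteps n) (scoreLevel n) + c ^ 2) +
      16 * Real.exp (-(Real.log 2 * margin n)) ^ 2 +
      4 * (Real.exp (-((1 - Real.log 2) * margin n)) + 2 * Real.exp (-margin n)), ?_, ?_⟩
  · have h1 := ((((hexp.add (hb1.pow 2)).add (tendsto_sixteen_mul_div_sq hl2)).sub
      (hb2.const_mul (2 * c))).add_const (c ^ 2)).const_mul 16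
    have h2 := ((((hexp.add (hb0.pow 2)).add (tendsto_sixteen_mul_div_sq hl1)).sub
      (hb1.const_mul (2 * c))).add_const (c ^ 2)).const_mul 16
    have h3 := (((h1.add h2).add ((hη.pow 2).const_mul 16)).add
      ((hη'.add (hexp.const_mul 2)).const_mul 4))
    refine h3.trans (le_of_eq ?_)
    congr 1
    ring
  · intro n hn j
    have hn' : (2 : ℝ) ≤ n := by exact_mod_cast hn
    refine (avgLists_dist_sub_sq_le hn (l n) (mixSteps n) j (scoreLevel n) c).trans ?_
    have e1 : (1 - 1 / (n : ℝ)) ^ mixSteps n ≤ Real.exp (-margin n) :=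
      one_sub_one_div_pow_mixSteps_le (by linarith) le_rfl
    have e2 : (1 - 1 / ((n : ℝ) - 1)) ^ mixSteps n ≤ Real.exp (-margin n) :=
      one_sub_one_div_pow_mixSteps_le (by linarith) (by linarith)
    have hpos : (0 : ℝ) < n := by linarith
    have e3 : (2 : ℝ) ^ scoreLevel n / n ≤ Real.exp (-(Real.log 2 * margin n)) := by
      rw [div_le_iff₀ hpos, ← mul_neg, ← Real.rpow_def_of_pos two_pos, ← Real.rpow_intCast]
      calc (2 : ℝ) ^ (scoreLevel n : ℝ) ≤ 2 ^ (-margin n + Real.logb 2 n) := by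
            refine Real.rpow_le_rpow_of_exponent_le one_le_two ?_
            linarith [scoreLevel_le n]
        _ = _ := by rw [Real.rpow_add two_pos, two_rpow_logb_natCast hn]
    have e4 : n * (2 : ℝ) ^ (-(scoreLevel n + 1)) ≤ Real.exp (Real.log 2 * margin n) := by
      rw [← Real.rpow_def_of_pos two_pos, ← Real.rpow_intCast]
      calc n * (2 : ℝ) ^ ((-(scoreLevel n + 1) : ℤ) : ℝ)
          ≤ n * 2 ^ (margin n - Real.logb 2 n) := by
            gcongr
            · exact one_le_two
            · push_cast
              linarith [lt_scoreLevel_add_one n]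
        _ = _ := by
          rw [Real.rpow_sub two_pos, two_rpow_logb_natCast hn]
          field_simp
    have e5 : n * (1 / ((n : ℝ) - 1)) ≤ 2 := by
      rw [mul_one_div, div_le_iff₀ (by linarith)]; linarith
    have e6 : n * ((1 - 1 / ((n : ℝ) - 1)) ^ mixSteps n *
        (2 ^ (-(scoreLevel n + 1)) + 1 / (n - 1))) ≤
        Real.exp (-((1 - Real.log 2) * margin n)) + 2 * Real.exp (-margin n) := by
      have e7 : Real.exp (-((1 - Real.log 2) * margin n)) =
          Real.exp (-margin n) * Real.exp (Real.log 2 * margin n) := by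
        rw [← Real.exp_add]; ring_nf
      calc _ = (1 - 1 / ((n : ℝ) - 1)) ^ mixSteps n *
            (n * 2 ^ (-(scoreLevel n + 1)) + n * (1 / (n - 1))) := by ring
        _ ≤ Real.exp (-margin n) * (Real.exp (Real.log 2 * margin n) + 2) := by
          refine mul_le_mul e2 (add_le_add e4 e5) ?_ (Real.exp_pos _).le
          have : (0 : ℝ) < n - 1 := by linarith
          positivity
        _ = _ := by rw [e7]; ring
    have e8 : ((2 : ℝ) ^ scoreLevel n / n) ^ 2 ≤ Real.exp (-(Real.log 2 * margin n)) ^ 2 :=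
      pow_le_pow_left₀ (by positivity) e3 2
    push_cast
    linarith

lemma eventually_cutoffTime_nonneg (a : ℝ) : ∀ᶠ n : ℕ in atTop, 0 ≤ cutoffTime n a := by
  filter_upwards [tendsto_sqrt_logb.eventually_ge_atTop (-a),
    tendsto_logb_natCast.eventually_gt_atTop 0] with n h1 h2
  have e : Real.logb 2 n + a * √(Real.logb 2 n) =
      √(Real.logb 2 n) * (√(Real.logb 2 n) + a) := by
    rw [mul_add, Real.mul_self_sqrt h2.le]; ring
  have h3 := Real.sqrt_nonneg (Real.logb 2 n)
  rw [cutoffTime, e]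
  have : 0 ≤ √(Real.logb 2 n) + a := by linarith
  positivity

/-- The distance at the cutoff times is close to `2 Φ(-a)` in mean square. The two mixing periods
before the cutoff time are negligible against the window. -/
lemma exists_cutoffTime_bound (a : ℝ) :
    ∃ B : ℕ → ℝ, Tendsto B atTop (𝓝 0) ∧ ∀ᶠ n : ℕ in atTop, ∀ j : Fin n,
      avgLists ⌊cutoffTime n a⌋₊ (fun L =>
        (∑ i, |averageList L (Pi.single j 1) i - 1 / n| - 2 * stdNormalCDF (-a)) ^ 2) ≤ B n := by
  have hmix : Tendsto (fun n : ℕ => 2 / n * ((mixSteps n + mixSteps n : ℕ) : ℝ)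
      / √(Real.logb 2 n)) atTop (𝓝 0) := by
    have h2 := tendsto_mixSteps_div.add tendsto_mixSteps_div
    rw [add_zero] at h2
    refine h2.congr fun n => ?_
    push_cast
    ring
  have hcut : Tendsto (fun n : ℕ => (2 / n * (⌊cutoffTime n a⌋₊ : ℝ) - Real.logb 2 n)
      / √(Real.logb 2 n)) atTop (𝓝 a) := by
    have h := (tendsto_div_sqrt_logb_of_le (C := 1)
      (f := fun n : ℕ => 2 / n * (cutoffTime n a - ⌊cutoffTime n a⌋₊)) ?_).const_sub a
    · rw [sub_zero] at h
      refine h.congr' ?_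
      filter_upwards [tendsto_logb_natCast.eventually_gt_atTop 0, eventually_ge_atTop 2]
        with n hn h2
      have hs : 0 < √(Real.logb 2 n) := Real.sqrt_pos.2 hn
      have hn' : (2 : ℝ) ≤ n := by exact_mod_cast h2
      have e : 2 / (n : ℝ) * cutoffTime n a = Real.logb 2 n + a * √(Real.logb 2 n) := by
        rw [cutoffTime]; field_simp
      rw [mul_sub, e]
      field_simp
      ring
    · filter_upwards [eventually_cutoffTime_nonneg a, eventually_ge_atTop 2] with n hn h2
      have hn' : (2 : ℝ) ≤ n := by exact_mod_cast h2
      have h3 := Nat.floor_le hn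
      have h4 := Nat.lt_floor_add_one (cutoffTime n a)
      have h5 := margin_nonneg n
      have h6 := two_div_le_one h2
      have h7 : (0 : ℝ) ≤ 2 / n := by positivity
      refine ⟨mul_nonneg h7 (by linarith), ?_⟩
      nlinarith
  have hle : ∀ᶠ n : ℕ in atTop, mixSteps n + mixSteps n ≤ ⌊cutoffTime n a⌋₊ := by
    filter_upwards [(hcut.add_atTop tendsto_sqrt_logb).eventually_ge_atTop 1,
      hmix.eventually_le_const one_pos, tendsto_logb_natCast.eventually_gt_atTop 0,
      eventually_ge_atTop 2] with n h1 h2 hL hn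
    have hs : 0 < √(Real.logb 2 n) := Real.sqrt_pos.2 hL
    have hn' : (0 : ℝ) < 2 / n := by positivity
    have e : Real.logb 2 n / √(Real.logb 2 n) = √(Real.logb 2 n) := Real.div_sqrt
    rw [sub_div, e, sub_add_cancel] at h1
    have h3 := (div_le_div_iff_of_pos_right hs).1 (h2.trans h1)
    exact_mod_cast le_of_mul_le_mul_left h3 hn'
  obtain ⟨B, hB, hb⟩ := exists_meanSquare_bound (a := a)
    (l := fun n => ⌊cutoffTime n a⌋₊ - (mixSteps n + mixSteps n)) (by
      have h := hcut.sub hmix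
      rw [sub_zero] at h
      refine h.congr' ?_
      filter_upwards [hle] with n hn
      rw [← sub_div, Nat.cast_sub hn]
      congr 1
      ring)
  refine ⟨B, hB, ?_⟩
  filter_upwards [hle, eventually_ge_atTop 2] with n hn h2 j
  have := hb n h2 j
  rwa [add_assoc, Nat.sub_add_cancel hn] at this

end Asymptotics

/-! ### The normal distribution function and the Poisson law -/

section Laws

lemma continuous_stdNormalCDF : Continuous stdNormalCDF := by
  have := nullSingletonClass_gaussianReal (μ := 0) (v := 1) one_ne_zero
  refine continuous_iff_continuousAt.2 fun x => ?_
  refine (monotone_cdf (gaussianReal 0 1)).continuousAt_iff_leftLim_eq_rightLim.2 ?_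
  rw [StieltjesFunction.rightLim_eq]
  have h := (cdf (gaussianReal 0 1)).measure_singleton x
  rw [measure_cdf, measure_singleton, eq_comm, ENNReal.ofReal_eq_zero] at h
  exact le_antisymm ((monotone_cdf _).leftLim_le le_rfl) (by linarith)

lemma stdNormalCDF_zero : stdNormalCDF 0 = 1 / 2 := by
  have := nullSingletonClass_gaussianReal (μ := 0) (v := 1) one_ne_zero
  have h1 : (gaussianReal 0 1).real (Set.Ioi 0) = (gaussianReal 0 1).real (Set.Iic 0) := by
    have e : gaussianReal 0 1 = (gaussianReal 0 1).map fun x => -x := by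
      rw [gaussianReal_map_neg, neg_zero]
    have e2 : (fun x : ℝ => -x) ⁻¹' Set.Iic 0 = Set.Ici 0 := by ext; simp
    conv_rhs => rw [e, map_measureReal_apply (by fun_prop) measurableSet_Iic, e2]
    exact measureReal_congr Ioi_ae_eq_Ici
  have h2 := probReal_add_probReal_compl (μ := gaussianReal 0 1) (measurableSet_Iic (a := (0 : ℝ)))
  rw [Set.compl_Iic, h1] at h2
  rw [stdNormalCDF, cdf_eq_real]
  linarith

/-- The variance of a Poisson law. -/
lemma hasSum_poisson_sq (r : ℝ≥0) :
    HasSum (fun x : ℕ => Real.exp (-r) * r ^ x / x.factorial * ((x : ℝ) - r) ^ 2) r := by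
  have h0 := hasSum_one_poissonMeasure r
  have h1 : HasSum (fun x : ℕ => Real.exp (-r) * r ^ x / x.factorial * x) r := by
    rw [← hasSum_nat_add_iff' 1]
    have := h0.mul_left (r : ℝ)
    simp only [Finset.sum_range_one, Nat.cast_zero, mul_zero, sub_zero]
    rw [mul_one] at this
    refine this.congr_fun fun x => ?_
    rw [Nat.factorial_succ]
    push_cast
    field_simp
    ring
  have h2 : HasSum (fun x : ℕ => Real.exp (-r) * r ^ x / x.factorial * x ^ 2)
      ((r : ℝ) * (r + 1)) := by
    rw [← hasSum_nat_add_iff' 1]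
    have := (h1.add h0).mul_left (r : ℝ)
    simp only [Finset.sum_range_one, Nat.cast_zero, ne_eq, OfNat.ofNat_ne_zero, not_false_eq_true,
      zero_pow, mul_zero, sub_zero]
    refine this.congr_fun fun x => ?_
    rw [Nat.factorial_succ]
    push_cast
    field_simp
    ring
  have h := (h2.add (h1.mul_left (-2 * (r : ℝ)))).add (h0.mul_left ((r : ℝ) ^ 2))
  have e : (r : ℝ) * (r + 1) + -2 * r * r + r ^ 2 * 1 = r := by ring
  rw [e] at h
  refine h.congr_fun fun x => ?_
  ring

lemma poissonMeasure_deviation_le (r : ℝ≥0) {d : ℝ} (hd : 0 < d) :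
    (poissonMeasure r).real {x | d ≤ |(x : ℝ) - r|} ≤ r / d ^ 2 := by
  have hint : Integrable (fun x : ℕ => ((x : ℝ) - r) ^ 2) (poissonMeasure r) := by
    rw [integrable_poissonMeasure_iff]
    refine (hasSum_poisson_sq r).summable.congr fun x => ?_
    rw [Real.norm_eq_abs, abs_of_nonneg (sq_nonneg _)]
  have h := mul_meas_ge_le_integral_of_nonneg (ae_of_all _ fun x : ℕ => sq_nonneg ((x : ℝ) - r)) hint
    (d ^ 2)
  have e : ∫ x : ℕ, ((x : ℝ) - r) ^ 2 ∂poissonMeasure r = r := by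
    rw [integral_poissonMeasure]
    exact (hasSum_poisson_sq r).tsum_eq
  have e2 : {x : ℕ | d ≤ |(x : ℝ) - r|} = {x : ℕ | d ^ 2 ≤ ((x : ℝ) - r) ^ 2} := by
    ext x
    simp only [Set.mem_ofPred_eq]
    rw [← sq_abs ((x : ℝ) - r), pow_le_pow_iff_left₀ hd.le (abs_nonneg _) two_ne_zero]
  rw [e, ← e2] at h
  rw [le_div_iff₀ (by positivity), mul_comm]
  exact h

lemma IsPoissonProcess.deviation_le {Ω : Type*} [MeasurableSpace Ω] {P : Measure Ω}
    {N : ℝ≥0 → Ω → ℕ} (hN : IsPoissonProcess P N) (t : ℝ≥0) {d : ℝ} (hd : 0 < d) :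
    P.real {ω | d ≤ |(N t ω : ℝ) - t|} ≤ t / d ^ 2 := by
  have hlaw : P.map (N t) = poissonMeasure t := by
    have h := hN.law 0 t zero_le
    rw [tsub_zero] at h
    rw [← h]
    refine Measure.map_congr ?_
    filter_upwards [hN.zero] with ω hω
    simp [hω]
  have := poissonMeasure_deviation_le t hd
  rwa [← hlaw, map_measureReal_apply (hN.measurable t) .of_discrete] at this

end Laws

/-! ### Convergence in probability -/

section Convergence

variable {n : ℕ}

lemma T_nonneg (q : ℕ → Fin n × Fin n) (k : ℕ) : 0 ≤ T q k :=
  Finset.sum_nonneg fun _ _ => abs_nonneg _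

lemma T_antitone (q : ℕ → Fin n × Fin n) : Antitone (T q) :=
  antitone_nat_of_succ_le fun k => dist_averagePair_le (q k) _ _

lemma T_le_two (hn : 2 ≤ n) (q : ℕ → Fin n × Fin n) (k : ℕ) : T q k ≤ 2 := by
  have : NeZero n := ⟨by omega⟩
  have hn' : (0 : ℝ) < n := by positivity
  refine (T_antitone q (Nat.zero_le k)).trans ?_
  rw [T_eq]
  have h : ∀ i : Fin n, |averageList ((List.range 0).map q) (Pi.single 0 1) i - 1 / n| ≤
      (Pi.single 0 1 : Fin n → ℝ) i + 1 / n := by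
    intro i
    have h1 : (0 : ℝ) < 1 / n := by positivity
    have h2 : 0 ≤ (Pi.single 0 1 : Fin n → ℝ) i := by
      rw [Pi.single_apply]; split_ifs <;> simp
    simp only [List.range_zero, List.map_nil, averageList, List.foldl_nil]
    rw [abs_le]
    constructor <;> linarith
  refine (Finset.sum_le_sum fun i _ => h i).trans (le_of_eq ?_)
  simp only [Finset.sum_add_distrib, Finset.sum_pi_single', Finset.mem_univ, if_true,
    Finset.sum_const, Finset.card_univ, Fintype.card_fin, nsmul_eq_mul]
  field_simp
  norm_num

/-- Chebyshev's inequality for the distance. -/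
lemma IsUniformPairs.real_le_avgLists {Ω : Type*} [MeasurableSpace Ω] {P : Measure Ω}
    [IsProbabilityMeasure P] {p : ℕ → Ω → Fin n × Fin n} (hp : IsUniformPairs P p) [NeZero n]
    (k : ℕ) (c : ℝ) {ε : ℝ} (hε : 0 < ε) :
    P.real {ω | ε ≤ |T (fun j => p j ω) k - c|} ≤ avgLists k (fun L =>
      (∑ i, |averageList L (Pi.single (0 : Fin n) 1) i - 1 / n| - c) ^ 2) / ε ^ 2 := by
  set F : List (Fin n × Fin n) → ℝ := fun L =>
    (∑ i, |averageList L (Pi.single (0 : Fin n) 1) i - 1 / n| - c) ^ 2 with hF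
  have hm : Measurable fun ω (i : Fin k) => p i ω := measurable_pi_lambda _ fun i => hp.measurable i
  have hint : Integrable (fun ω => F ((List.range k).map fun j => p j ω)) P := by
    have := Measure.isProbabilityMeasure_map (μ := P) hm.aemeasurable
    have h := (Integrable.of_finite (μ := P.map fun ω (i : Fin k) => p i ω)
      (f := fun v : Fin k → Fin n × Fin n => F (List.ofFn v))).comp_measurable hm
    refine h.congr (ae_of_all _ fun ω => ?_)
    simp only [Function.comp_apply]
    congr 1
    apply List.ext_getElem <;> simp
  have h := mul_meas_ge_le_integral_of_nonneg (ae_of_all _ fun ω => sq_nonneg _) hint (ε ^ 2)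
  rw [hp.integral_eq_avgLists k F] at h
  have e : {ω | ε ≤ |T (fun j => p j ω) k - c|} =
      {ω | ε ^ 2 ≤ F ((List.range k).map fun j => p j ω)} := by
    ext ω
    simp only [Set.mem_ofPred_eq, hF]
    rw [← T_eq, ← sq_abs (T _ k - c), pow_le_pow_iff_left₀ hε.le (abs_nonneg _) two_ne_zero]
  rw [e, le_div_iff₀ (by positivity), mul_comm]
  exact h

variable {Ω : Set.Ici (2 : ℕ) → Type*} [∀ n, MeasurableSpace (Ω n)]
  {P : ∀ n, Measure (Ω n)} {p : ∀ n : Set.Ici (2 : ℕ), ℕ → Ω n → Fin n × Fin n}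

lemma eventually_Ici {Q : ℕ → Prop} (h : ∀ᶠ n in atTop, Q n) :
    ∀ᶠ n : Set.Ici (2 : ℕ) in atTop, Q n := by
  rw [← map_val_Ici_atTop 2] at h
  exact h

lemma tendstoInProb_cutoffTime [∀ n, IsProbabilityMeasure (P n)]
    (hp : ∀ n, IsUniformPairs (P n) (p n)) (a : ℝ) :
    TendstoInProb P (fun n ω => T (fun k => p n k ω) ⌊cutoffTime n a⌋₊)
      (2 * stdNormalCDF (-a)) := by
  intro ε hε
  obtain ⟨B, hB, hb⟩ := exists_cutoffTime_bound a
  have h := ENNReal.tendsto_ofReal (tendsto_comp_val_Ici_atTop.2 (hB.div_const (ε ^ 2)) :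
    Tendsto (fun n : Set.Ici 2 => B n / ε ^ 2) atTop _)
  rw [zero_div, ENNReal.ofReal_zero] at h
  refine tendsto_of_tendsto_of_tendsto_of_le_of_le' tendsto_const_nhds h
    (Eventually.of_forall fun n => zero_le) ?_
  filter_upwards [eventually_Ici hb] with n hn
  have : NeZero (n : ℕ) := ⟨by have := n.2; simp only [Set.mem_Ici] at this; omega⟩
  rw [← ofReal_measureReal]
  refine ENNReal.ofReal_le_ofReal (((hp n).real_le_avgLists _ _ hε).trans ?_)
  exact div_le_div_of_nonneg_right (hn 0) (by positivity)

/-- At random times that eventually exceed a cutoff time, the distance is eventually not much above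
the value at the cutoff time. -/
lemma tendsto_measure_upper {K : ∀ n, Ω n → ℕ} {a c ε : ℝ}
    (hT : TendstoInProb P (fun n ω => T (fun k => p n k ω) ⌊cutoffTime n a⌋₊)
      (2 * stdNormalCDF (-a)))
    (hc : 2 * stdNormalCDF (-a) < c + ε)
    (hK : Tendsto (fun n => P n {ω | K n ω < ⌊cutoffTime n a⌋₊}) atTop (𝓝 0)) :
    Tendsto (fun n => P n {ω | ε ≤ T (fun k => p n k ω) (K n ω) - c}) atTop (𝓝 0) := by
  have h := hK.add (hT (c + ε - 2 * stdNormalCDF (-a)) (by linarith))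
  rw [add_zero] at h
  refine tendsto_of_tendsto_of_tendsto_of_le_of_le tendsto_const_nhds h (fun n => zero_le)
    fun n => (measure_mono fun ω hω => ?_).trans (measure_union_le _ _)
  by_cases hω' : K n ω < ⌊cutoffTime n a⌋₊
  · exact Or.inl hω'
  · refine Or.inr ?_
    have := T_antitone (fun k => p n k ω) (not_lt.1 hω')
    simp only [Set.mem_ofPred_eq] at hω ⊢
    refine le_trans ?_ (le_abs_self _)
    linarith

lemma tendsto_measure_lower {K : ∀ n, Ω n → ℕ} {a c ε : ℝ}
    (hT : TendstoInProb P (fun n ω => T (fun k => p n k ω) ⌊cutoffTime n a⌋₊)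
      (2 * stdNormalCDF (-a)))
    (hc : c - ε < 2 * stdNormalCDF (-a))
    (hK : Tendsto (fun n => P n {ω | ⌊cutoffTime n a⌋₊ < K n ω}) atTop (𝓝 0)) :
    Tendsto (fun n => P n {ω | ε ≤ c - T (fun k => p n k ω) (K n ω)}) atTop (𝓝 0) := by
  have h := hK.add (hT (2 * stdNormalCDF (-a) - (c - ε)) (by linarith))
  rw [add_zero] at h
  refine tendsto_of_tendsto_of_tendsto_of_le_of_le tendsto_const_nhds h (fun n => zero_le)
    fun n => (measure_mono fun ω hω => ?_).trans (measure_union_le _ _)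
  by_cases hω' : ⌊cutoffTime n a⌋₊ < K n ω
  · exact Or.inl hω'
  · refine Or.inr ?_
    have := T_antitone (fun k => p n k ω) (not_lt.1 hω')
    simp only [Set.mem_ofPred_eq] at hω ⊢
    rw [abs_sub_comm]
    refine le_trans ?_ (le_abs_self _)
    linarith

lemma tendstoInProb_of_upper_lower {X : ∀ n, Ω n → ℝ} {c : ℝ}
    (h1 : ∀ ε : ℝ, 0 < ε → Tendsto (fun n => P n {ω | ε ≤ X n ω - c}) atTop (𝓝 0))
    (h2 : ∀ ε : ℝ, 0 < ε → Tendsto (fun n => P n {ω | ε ≤ c - X n ω}) atTop (𝓝 0)) :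
    TendstoInProb P X c := by
  intro ε hε
  have h := (h1 ε hε).add (h2 ε hε)
  rw [add_zero] at h
  refine tendsto_of_tendsto_of_tendsto_of_le_of_le tendsto_const_nhds h (fun n => zero_le)
    fun n => (measure_mono fun ω hω => ?_).trans (measure_union_le _ _)
  rcases le_abs'.1 (show ε ≤ |X n ω - c| from hω) with h | h
  · exact Or.inr (show ε ≤ c - X n ω by linarith)
  · exact Or.inl h

/-- The limit at random times that are squeezed between the cutoff times with parameters `a - δ`
and `a + δ`. -/
lemma tendstoInProb_of_near {K : ∀ n, Ω n → ℕ} {a : ℝ}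
    (hT : ∀ b, TendstoInProb P (fun n ω => T (fun k => p n k ω) ⌊cutoffTime n b⌋₊)
      (2 * stdNormalCDF (-b)))
    (h1 : ∀ δ : ℝ, 0 < δ →
      Tendsto (fun n => P n {ω | K n ω < ⌊cutoffTime n (a - δ)⌋₊}) atTop (𝓝 0))
    (h2 : ∀ δ : ℝ, 0 < δ →
      Tendsto (fun n => P n {ω | ⌊cutoffTime n (a + δ)⌋₊ < K n ω}) atTop (𝓝 0)) :
    TendstoInProb P (fun n ω => T (fun k => p n k ω) (K n ω)) (2 * stdNormalCDF (-a)) := by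
  have hcont : ∀ ε : ℝ, 0 < ε → ∃ δ : ℝ, 0 < δ ∧
      2 * stdNormalCDF (-(a - δ)) < 2 * stdNormalCDF (-a) + ε ∧
      2 * stdNormalCDF (-a) - ε < 2 * stdNormalCDF (-(a + δ)) := by
    intro ε hε
    have c1 : Tendsto (fun δ => 2 * stdNormalCDF (-(a - δ))) (𝓝[>] 0)
        (𝓝 (2 * stdNormalCDF (-(a - 0)))) :=
      ((continuous_stdNormalCDF.comp (by fun_prop : Continuous fun δ => -(a - δ))).const_mul
        2).continuousWithinAt
    have c2 : Tendsto (fun δ => 2 * stdNormalCDF (-(a + δ))) (𝓝[>] 0)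
        (𝓝 (2 * stdNormalCDF (-(a + 0)))) :=
      ((continuous_stdNormalCDF.comp (by fun_prop : Continuous fun δ => -(a + δ))).const_mul
        2).continuousWithinAt
    rw [sub_zero] at c1
    rw [add_zero] at c2
    obtain ⟨δ, h1, h2, h3⟩ := ((c1.eventually_lt_const (lt_add_of_pos_right _ hε)).and
      ((c2.eventually_const_lt (sub_lt_self _ hε)).and self_mem_nhdsWithin)).exists
    exact ⟨δ, h3, h1, h2⟩
  refine tendstoInProb_of_upper_lower (fun ε hε => ?_) (fun ε hε => ?_)
  · obtain ⟨δ, hδ, h, -⟩ := hcont ε hε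
    exact tendsto_measure_upper (hT _) h (h1 δ hδ)
  · obtain ⟨δ, hδ, -, h⟩ := hcont ε hε
    exact tendsto_measure_lower (hT _) h (h2 δ hδ)

lemma tendsto_measure_of_eventually_not {S : ∀ n, Ω n → Prop}
    (h : ∀ᶠ n : Set.Ici (2 : ℕ) in atTop, ∀ ω, ¬ S n ω) :
    Tendsto (fun n => P n {ω | S n ω}) atTop (𝓝 0) := by
  refine tendsto_const_nhds.congr' ?_
  filter_upwards [h] with n hn
  simp [hn]

lemma tendsto_poisson_deviation [∀ n, IsProbabilityMeasure (P n)]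
    {N : ∀ n : Set.Ici (2 : ℕ), ℝ≥0 → Ω n → ℕ}
    (hN : ∀ n, IsPoissonProcess (P n) (N n)) (a : ℝ) {δ : ℝ} (hδ : 0 < δ) :
    Tendsto (fun n => P n {ω | n * (δ * √(Real.logb 2 n)) / 2 ≤
      |(N n (cutoffTime n a).toNNReal ω : ℝ) - ((cutoffTime n a).toNNReal : ℝ)|})
      atTop (𝓝 0) := by
  have hlim : Tendsto (fun n : ℕ => 2 / δ ^ 2 * ((1 + a * (√(Real.logb 2 n))⁻¹) * (n : ℝ)⁻¹))
      atTop (𝓝 0) := by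
    have h1 := ((tendsto_inv_atTop_zero.comp tendsto_sqrt_logb).const_mul a).const_add 1
    have h2 := (h1.mul (tendsto_inv_atTop_nhds_zero_nat (𝕜 := ℝ))).const_mul (2 / δ ^ 2)
    rw [mul_zero, mul_zero] at h2
    exact h2
  have h := ENNReal.tendsto_ofReal (tendsto_comp_val_Ici_atTop.2 hlim :
    Tendsto (fun n : Set.Ici 2 => 2 / δ ^ 2 * ((1 + a * (√(Real.logb 2 (n : ℕ)))⁻¹) *
      ((n : ℕ) : ℝ)⁻¹)) atTop _)
  rw [ENNReal.ofReal_zero] at h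
  refine tendsto_of_tendsto_of_tendsto_of_le_of_le' tendsto_const_nhds h
    (Eventually.of_forall fun n => zero_le) ?_
  filter_upwards [eventually_Ici (eventually_cutoffTime_nonneg a),
    eventually_Ici (tendsto_logb_natCast.eventually_gt_atTop 0)] with n h0 hL
  have hn : (0 : ℝ) < (n : ℕ) := by
    have := n.2; simp only [Set.mem_Ici] at this
    exact_mod_cast (by omega : 0 < (n : ℕ))
  have hs : 0 < √(Real.logb 2 (n : ℕ)) := Real.sqrt_pos.2 hL
  rw [← ofReal_measureReal]
  refine ENNReal.ofReal_le_ofReal (((hN n).deviation_le _ (by positivity)).trans (le_of_eq ?_))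
  rw [Real.coe_toNNReal _ h0, cutoffTime]
  have e : Real.logb 2 (n : ℕ) = √(Real.logb 2 (n : ℕ)) ^ 2 := (Real.sq_sqrt hL.le).symm
  set s := √(Real.logb 2 (n : ℕ))
  rw [e]
  field_simp

lemma tendstoInProb_poisson [∀ n, IsProbabilityMeasure (P n)]
    {N : ∀ n : Set.Ici (2 : ℕ), ℝ≥0 → Ω n → ℕ}
    (hT : ∀ b, TendstoInProb P (fun n ω => T (fun k => p n k ω) ⌊cutoffTime n b⌋₊)
      (2 * stdNormalCDF (-b)))
    (hN : ∀ n, IsPoissonProcess (P n) (N n)) (a : ℝ) :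
    TendstoInProb P (fun n ω => T (fun k => p n k ω) (N n (cutoffTime n a).toNNReal ω))
      (2 * stdNormalCDF (-a)) := by
  refine tendstoInProb_of_near hT (fun δ hδ => ?_) (fun δ hδ => ?_)
  · refine tendsto_of_tendsto_of_tendsto_of_le_of_le' tendsto_const_nhds
      (tendsto_poisson_deviation hN a hδ) (Eventually.of_forall fun n => zero_le) ?_
    filter_upwards [eventually_Ici (eventually_cutoffTime_nonneg a),
      eventually_Ici (eventually_cutoffTime_nonneg (a - δ))] with n h0 h1
    refine measure_mono fun ω hω => ?_
    simp only [Set.mem_ofPred_eq] at hω ⊢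
    have h2 : (N n (cutoffTime n a).toNNReal ω : ℝ) < cutoffTime n (a - δ) :=
      (Nat.cast_lt.2 hω).trans_le (Nat.floor_le h1)
    rw [Real.coe_toNNReal _ h0, abs_sub_comm]
    refine le_trans ?_ (le_abs_self _)
    simp only [cutoffTime] at h2 ⊢
    linarith
  · refine tendsto_of_tendsto_of_tendsto_of_le_of_le' tendsto_const_nhds
      (tendsto_poisson_deviation hN a hδ) (Eventually.of_forall fun n => zero_le) ?_
    filter_upwards [eventually_Ici (eventually_cutoffTime_nonneg a)] with n h0
    refine measure_mono fun ω hω => ?_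
    simp only [Set.mem_ofPred_eq] at hω ⊢
    have h2 : cutoffTime n (a + δ) < N n (cutoffTime n a).toNNReal ω := Nat.lt_of_floor_lt hω
    rw [Real.coe_toNNReal _ h0]
    refine le_trans ?_ (le_abs_self _)
    simp only [cutoffTime] at h2 ⊢
    linarith

lemma cutoffTime_sub {n : ℕ} (hn : 2 ≤ n) (k : ℕ) (a : ℝ) :
    k - cutoffTime n a =
      n * √(Real.log n) * (windowPos n k - a / (2 * √(Real.log 2))) := by
  have hn' : (0 : ℝ) < n := by positivity
  have h1 : 0 < √(Real.log n) :=
    Real.sqrt_pos.2 (Real.log_pos (by exact_mod_cast (by omega : 1 < n)))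
  have h2 : 0 < √(Real.log 2) := Real.sqrt_pos.2 (Real.log_pos one_lt_two)
  have e : √(Real.logb 2 n) = √(Real.log n) / √(Real.log 2) := by
    rw [Real.logb, Real.sqrt_div' _ (Real.log_pos one_lt_two).le]
  rw [cutoffTime, windowPos, e]
  field_simp
  ring

lemma lt_cutoffTime_iff {n : ℕ} (hn : 2 ≤ n) (k : ℕ) (a : ℝ) :
    k < cutoffTime n a ↔ windowPos n k < a / (2 * √(Real.log 2)) := by
  have h1 : 0 < n * √(Real.log n) := mul_pos (by positivity)
    (Real.sqrt_pos.2 (Real.log_pos (by exact_mod_cast (by omega : 1 < n))))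
  rw [← sub_neg, cutoffTime_sub hn, ← sub_neg (a := windowPos n k)]
  exact smul_neg_iff_of_pos_left h1

lemma cutoffTime_lt_iff {n : ℕ} (hn : 2 ≤ n) (k : ℕ) (a : ℝ) :
    cutoffTime n a < k ↔ a / (2 * √(Real.log 2)) < windowPos n k := by
  have h1 : 0 < n * √(Real.log n) := mul_pos (by positivity)
    (Real.sqrt_pos.2 (Real.log_pos (by exact_mod_cast (by omega : 1 < n))))
  rw [← sub_pos, cutoffTime_sub hn, mul_pos_iff_of_pos_left h1, sub_pos]

lemma not_lt_floor_cutoffTime {n k : ℕ} (hn : 2 ≤ n) {a : ℝ}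
    (h : a / (2 * √(Real.log 2)) < windowPos n k) : ¬ k < ⌊cutoffTime n a⌋₊ :=
  not_lt.2 (Nat.floor_le_of_le ((cutoffTime_lt_iff hn k a).2 h).le)

lemma not_floor_cutoffTime_lt {n k : ℕ} (hn : 2 ≤ n) {a : ℝ}
    (h : windowPos n k < a / (2 * √(Real.log 2))) : ¬ ⌊cutoffTime n a⌋₊ < k :=
  not_lt.2 (Nat.le_floor ((lt_cutoffTime_iff hn k a).2 h).le)

lemma tendstoInProb_of_windowPos {k : Set.Ici (2 : ℕ) → ℕ}
    (hT : ∀ b, TendstoInProb P (fun n ω => T (fun k => p n k ω) ⌊cutoffTime n b⌋₊)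
      (2 * stdNormalCDF (-b))) :
    (Tendsto (fun n : Set.Ici (2 : ℕ) => windowPos n (k n)) atTop atBot →
      TendstoInProb P (fun n ω => T (fun j => p n j ω) (k n)) 2) ∧
    (Tendsto (fun n : Set.Ici (2 : ℕ) => windowPos n (k n)) atTop (𝓝 0) →
      TendstoInProb P (fun n ω => T (fun j => p n j ω) (k n)) 1) ∧
    (Tendsto (fun n : Set.Ici (2 : ℕ) => windowPos n (k n)) atTop atTop →
      TendstoInProb P (fun n ω => T (fun j => p n j ω) (k n)) 0) := by
  have hl2 : 0 < √(Real.log 2) := Real.sqrt_pos.2 (Real.log_pos one_lt_two)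
  refine ⟨fun hk => ?_, fun hk => ?_, fun hk => ?_⟩
  · refine tendstoInProb_of_upper_lower (fun ε hε => ?_) (fun ε hε => ?_)
    · refine tendsto_measure_of_eventually_not (Eventually.of_forall fun n ω => ?_)
      linarith [T_le_two n.2 (fun j => p n j ω) (k n)]
    · have h1 : Tendsto (fun x => 2 * stdNormalCDF x) atTop (𝓝 (2 * 1)) :=
        (tendsto_cdf_atTop (gaussianReal 0 1)).const_mul 2
      obtain ⟨x, hx⟩ := (h1.eventually_const_lt (by linarith : 2 - ε < 2 * 1)).exists
      refine tendsto_measure_lower (K := fun n _ => k n) (hT (-x)) (by rwa [neg_neg]) ?_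
      refine tendsto_measure_of_eventually_not ?_
      filter_upwards [hk.eventually_lt_atBot (-x / (2 * √(Real.log 2)))] with n hn ω
      exact not_floor_cutoffTime_lt n.2 hn
  · have h : (1 : ℝ) = 2 * stdNormalCDF (-0) := by
      rw [neg_zero, stdNormalCDF_zero]; norm_num
    rw [h]
    refine tendstoInProb_of_near (K := fun n _ => k n) hT (fun δ hδ => ?_) (fun δ hδ => ?_)
    · refine tendsto_measure_of_eventually_not ?_
      have : (0 - δ) / (2 * √(Real.log 2)) < 0 := div_neg_of_neg_of_pos (by linarith) (by positivity)
      filter_upwards [hk.eventually_const_lt this] with n hn ω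
      exact not_lt_floor_cutoffTime n.2 hn
    · refine tendsto_measure_of_eventually_not ?_
      have : 0 < (0 + δ) / (2 * √(Real.log 2)) := by positivity
      filter_upwards [hk.eventually_lt_const this] with n hn ω
      exact not_floor_cutoffTime_lt n.2 hn
  · refine tendstoInProb_of_upper_lower (fun ε hε => ?_) (fun ε hε => ?_)
    · have h1 : Tendsto (fun x => 2 * stdNormalCDF x) atBot (𝓝 (2 * 0)) :=
        (tendsto_cdf_atBot (gaussianReal 0 1)).const_mul 2
      obtain ⟨x, hx⟩ := (h1.eventually_lt_const (by linarith : 2 * 0 < 0 + ε)).exists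
      refine tendsto_measure_upper (K := fun n _ => k n) (hT (-x)) (by rwa [neg_neg]) ?_
      refine tendsto_measure_of_eventually_not ?_
      filter_upwards [hk.eventually_gt_atTop (-x / (2 * √(Real.log 2)))] with n hn ω
      exact not_lt_floor_cutoffTime n.2 hn
    · refine tendsto_measure_of_eventually_not (Eventually.of_forall fun n ω => ?_)
      linarith [T_nonneg (fun j => p n j ω) (k n)]

end Convergence

end RepeatedAverages

/-- The index `n` runs through the integers `n ≥ 2`, for which a pair of distinct coordinates
exists. The times may be negative only for finitely many `n`, where they are read as `0`. -/
theorem theorem2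
    (Ω : Set.Ici (2 : ℕ) → Type*) [∀ n, MeasurableSpace (Ω n)]
    (P : ∀ n, Measure (Ω n)) [∀ n, IsProbabilityMeasure (P n)]
    (p : ∀ n : Set.Ici (2 : ℕ), ℕ → Ω n → Fin n × Fin n)
    (hp : ∀ n, IsUniformPairs (P n) (p n)) :
    -- discrete time
    (∀ a : ℝ, TendstoInProb P
      (fun n ω => T (fun k => p n k ω) ⌊cutoffTime n a⌋₊)
      (2 * stdNormalCDF (-a))) ∧
    -- continuous time: pairs are averaged at the rings of an independent rate one Poisson clock
    (∀ N : ∀ n : Set.Ici (2 : ℕ), ℝ≥0 → Ω n → ℕ,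
      (∀ n, IsPoissonProcess (P n) (N n)) →
      (∀ n, IndepFun (fun ω t => N n t ω) (fun ω k => p n k ω) (P n)) →
      ∀ a : ℝ, TendstoInProb P
        (fun n ω => T (fun k => p n k ω)
          (N n (cutoffTime n a).toNNReal ω))
        (2 * stdNormalCDF (-a))) ∧
    -- the cutoff at `n log₂ n / 2` has a window of order exactly `n √(log n)`
    (∀ k : Set.Ici (2 : ℕ) → ℕ,
      (Tendsto (fun n : Set.Ici (2 : ℕ) => windowPos n (k n)) atTop atBot →
        TendstoInProb P
          (fun n ω => T (fun j => p n j ω) (k n)) 2) ∧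
      (Tendsto (fun n : Set.Ici (2 : ℕ) => windowPos n (k n)) atTop (𝓝 0) →
        TendstoInProb P
          (fun n ω => T (fun j => p n j ω) (k n)) 1) ∧
      (Tendsto (fun n : Set.Ici (2 : ℕ) => windowPos n (k n)) atTop atTop →
        TendstoInProb P
          (fun n ω => T (fun j => p n j ω) (k n)) 0)) := by
  have hT := fun a => tendstoInProb_cutoffTime hp a
  exact ⟨hT, fun N hN _ a => tendstoInProb_poisson hT hN a,
    fun k => tendstoInProb_of_windowPos hT⟩
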